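/- Let $K$ be a field, $n\ge 0$, $S=K[x_1,\dots,x_n]$ with $\deg x_l=1$, and $E=K\langle y_1,\dots,y_n\rangle$ the exterior algebra on the dual basis, graded by $E_{-i}=\bigwedge^i$, so $\deg y_l=-1$. Graded $E$-modules are regarded as left and right modules with $ea=(-1)^{(\deg e)(\deg a)}ae$ for homogeneous $e\in E$ and $a$ in the module. For a graded module $M$ put $M(j)_i=M_{i+j}$, and for a complex $M^\bullet$ put $M^\bullet[j]^i=M^{i+j}$. For a bounded complex $N^\bullet$ of finitely generated graded $E$-modules with differential $\delta$, let $\mathbf L(N^\bullet)$ be the complex of graded free $S$-modules $\mathbf L(N^\bullet)^m=\bigoplus_{i-j=m}S\otimes_K N^i_j$ ($s\otimes z$ having degree $\deg s+\deg z$), with differential $$s\otimes z\mapsto \sum_{l=1}^n x_l s\otimes y_l z+(-1)^m s\otimes\delta(z)\qquad (z\in N^i_j,\ i-j=m),$$ and let $\mathbf D_E(N^\bullet)=\operatorname{Hom}_E(N^\bullet,E)$ be the complex of graded $E$-modules with $\mathbf D_E(N^\bullet)^i=\operatorname{Hom}_E(N^{-i},E)$. Let $\omega^\bullet$ be a graded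 injective resolution of $S(-n)[n]$ (for instance the minimal one), that is, a bounded below complex of injective objects of the category $\operatorname{Gr}S$ of graded $S$-modules with a quasi-isomorphism $S(-n)[n]\to\omega^\bullet$, and put $\mathbf D_S(-)=\operatorname{Hom}^\bullet_S(-,\omega^\bullet)$. Then for every $N^\bullet\in D^b(\operatorname{gr}E)$, i.e. every bounded complex of finitely generated graded $E$-modules, there is an isomorphism $$\mathbf D_S(\mathbf L(N^\bullet))\;\cong\;\mathbf L(\mathbf D_E(N^\bullet))(-2n)[2n]$$ in the derived category of graded $S$-modules (where $D^b(\operatorname{gr}S)$ is identified with the full subcategory of complexes with bounded, finitely generated cohomology), and these isomorphisms can be chosen natural in $N^\bullet$ with respect to chain maps. -/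

import Mathlib

open CategoryTheory TensorProduct DirectSum CochainComplex.HomComplex

universe u

noncomputable section

/-- A `ℤ`-graded left module over the `K`-algebra `A` with homogeneous pieces `𝒜 i`. -/
structure GrMod {K A : Type u} [Field K] [Ring A] [Algebra K A] (𝒜 : ℤ → Submodule K A) where
  carrier : Type u
  [addCommGroup : AddCommGroup carrier]
  [moduleK : Module K carrier]
  [moduleA : Module A carrier]
  [tower : IsScalarTower K A carrier]
  gr : ℤ → Submodule K carrier
  smul_mem : ∀ (i j : ℤ) (a : A) (m : carrier), a ∈ 𝒜 i → m ∈ gr j → a • m ∈ gr (i + j)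
  internal : DirectSum.IsInternal gr

attribute [instance] GrMod.addCommGroup GrMod.moduleK GrMod.moduleA GrMod.tower

namespace GrMod

section General

variable {K A : Type u} [Field K] [Ring A] [Algebra K A] {𝒜 : ℤ → Submodule K A}

/-- Degree-preserving `A`-linear maps. -/
@[ext]
structure Hom (M N : GrMod 𝒜) where
  lin : M.carrier →ₗ[A] N.carrier
  map_mem : ∀ (i : ℤ) (m : M.carrier), m ∈ M.gr i → lin m ∈ N.gr i

instance : Category (GrMod 𝒜) where
  Hom M N := Hom M N
  id M := ⟨LinearMap.id, fun _ _ h => h⟩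
  comp f g := ⟨g.lin ∘ₗ f.lin, fun i m h => g.map_mem i _ (f.map_mem i m h)⟩

/-- The linear map underlying a morphism. -/
def toLin {M N : GrMod 𝒜} (f : M ⟶ N) : M.carrier →ₗ[A] N.carrier := Hom.lin f

/-- The constructor for morphisms. -/
def ofLin {M N : GrMod 𝒜} (f : M.carrier →ₗ[A] N.carrier)
    (hf : ∀ (i : ℤ) (m : M.carrier), m ∈ M.gr i → f m ∈ N.gr i) : M ⟶ N := Hom.mk f hf

theorem toLin_mem {M N : GrMod 𝒜} (f : M ⟶ N) {i : ℤ} {m : M.carrier} (h : m ∈ M.gr i) :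
    toLin f m ∈ N.gr i := Hom.map_mem f i m h

@[simp] theorem toLin_ofLin {M N : GrMod 𝒜} (f : M.carrier →ₗ[A] N.carrier)
    (hf : ∀ (i : ℤ) (m : M.carrier), m ∈ M.gr i → f m ∈ N.gr i) :
    toLin (ofLin f hf) = f := rfl

@[simp] theorem toLin_id (M : GrMod 𝒜) : toLin (𝟙 M) = LinearMap.id := rfl

@[simp] theorem toLin_comp {M N P : GrMod 𝒜} (f : M ⟶ N) (g : N ⟶ P) :
    toLin (f ≫ g) = toLin g ∘ₗ toLin f := rfl

theorem hom_ext {M N : GrMod 𝒜} {f g : M ⟶ N} (h : toLin f = toLin g) : f = g := Hom.ext h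

instance (M N : GrMod 𝒜) : Zero (M ⟶ N) := ⟨ofLin 0 fun i _ _ => (N.gr i).zero_mem⟩

instance (M N : GrMod 𝒜) : Add (M ⟶ N) :=
  ⟨fun f g => ofLin (toLin f + toLin g) fun i _ h =>
    (N.gr i).add_mem (toLin_mem f h) (toLin_mem g h)⟩

instance (M N : GrMod 𝒜) : Neg (M ⟶ N) :=
  ⟨fun f => ofLin (-toLin f) fun i _ h => (N.gr i).neg_mem (toLin_mem f h)⟩

instance (M N : GrMod 𝒜) : Sub (M ⟶ N) :=
  ⟨fun f g => ofLin (toLin f - toLin g) fun i _ h =>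
    (N.gr i).sub_mem (toLin_mem f h) (toLin_mem g h)⟩

instance (M N : GrMod 𝒜) : SMul ℕ (M ⟶ N) :=
  ⟨fun k f => ofLin (k • toLin f) fun i _ h => (N.gr i).nsmul_mem (toLin_mem f h) k⟩

instance (M N : GrMod 𝒜) : SMul ℤ (M ⟶ N) :=
  ⟨fun k f => ofLin (k • toLin f) fun _ _ h => zsmul_mem (toLin_mem f h) k⟩

theorem toLin_injective (M N : GrMod 𝒜) :
    Function.Injective (toLin : (M ⟶ N) → (M.carrier →ₗ[A] N.carrier)) := fun _ _ h => hom_ext h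

instance (M N : GrMod 𝒜) : AddCommGroup (M ⟶ N) :=
  (toLin_injective M N).addCommGroup _ rfl (fun _ _ => rfl) (fun _ => rfl) (fun _ _ => rfl)
    (fun _ _ => rfl) (fun _ _ => rfl)

@[simp] theorem toLin_zero (M N : GrMod 𝒜) : toLin (0 : M ⟶ N) = 0 := rfl

@[simp] theorem toLin_add {M N : GrMod 𝒜} (f g : M ⟶ N) :
    toLin (f + g) = toLin f + toLin g := rfl

@[simp] theorem toLin_zsmul {M N : GrMod 𝒜} (k : ℤ) (f : M ⟶ N) :
    toLin (k • f) = k • toLin f := rfl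

@[simp] theorem toLin_unitsSMul {M N : GrMod 𝒜} (k : ℤˣ) (f : M ⟶ N) :
    toLin (k • f) = k • toLin f := rfl

instance : Preadditive (GrMod 𝒜) where
  add_comp _ _ _ f f' g := hom_ext (by simp [LinearMap.comp_add])
  comp_add _ _ _ f g g' := hom_ext (by simp [LinearMap.add_comp])

/-- The underlying (ungraded) module. -/
def forget (𝒜 : ℤ → Submodule K A) : GrMod 𝒜 ⥤ ModuleCat.{u} A where
  obj M := ModuleCat.of A M.carrier
  map f := ModuleCat.ofHom (toLin f)

instance : (forget 𝒜).Additive where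

/-- A zero object. -/
def zeroObj (𝒜 : ℤ → Submodule K A) : GrMod 𝒜 where
  carrier := PUnit
  gr _ := ⊤
  smul_mem _ _ _ _ _ _ := trivial
  internal := by
    refine DirectSum.isInternal_submodule_of_iSupIndep_of_iSup_eq_top ?_ (Subsingleton.elim _ _)
    intro i
    rw [disjoint_iff]
    exact Subsingleton.elim _ _

instance : Limits.HasZeroObject (GrMod 𝒜) :=
  ⟨zeroObj 𝒜, (Limits.IsZero.iff_id_eq_zero _).2 (hom_ext (LinearMap.ext fun _ => rfl))⟩

/-- The module `M(j)` with `M(j)_i = M_{i+j}`. -/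
def twistObj (j : ℤ) (M : GrMod 𝒜) : GrMod 𝒜 where
  carrier := M.carrier
  gr i := M.gr (i + j)
  smul_mem a i s m hs hm := by
    rw [add_assoc]
    exact M.smul_mem a (i + j) s m hs hm
  internal := by
    have h := M.internal
    rw [DirectSum.isInternal_submodule_iff_iSupIndep_and_iSup_eq_top] at h ⊢
    refine ⟨h.1.comp (add_left_injective j), ?_⟩
    rw [← h.2]
    exact (Equiv.addRight j).iSup_comp (g := M.gr)

/-- The twist `M ↦ M(j)` as a functor. -/
def twist (𝒜 : ℤ → Submodule K A) (j : ℤ) : GrMod 𝒜 ⥤ GrMod 𝒜 where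
  obj := twistObj j
  map {M N} f := ofLin (M := twistObj j M) (N := twistObj j N) (toLin (M := M) (N := N) f)
    fun i _ h => toLin_mem (M := M) (N := N) f (i := i + j) h

instance (j : ℤ) : (twist 𝒜 j).Additive where
  map_add := rfl

/-- The algebra as a graded module over itself. -/
def self (𝒜 : ℤ → Submodule K A) [SetLike.GradedMonoid 𝒜] (h : DirectSum.IsInternal 𝒜) :
    GrMod 𝒜 where
  carrier := A
  gr := 𝒜
  smul_mem _ _ _ _ ha hm := SetLike.mul_mem_graded ha hm
  internal := h

/-- Given independent subspaces `G d` of an `A`-module `H` with `𝒜 i • G j ⊆ G (i + j)`, the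
graded module `⨁ d, G d`, realised as the `A`-submodule of `H` generated by the `G d`. -/
def ofPieces (h𝒜 : ⨆ i, 𝒜 i = ⊤) (H : Type u) [AddCommGroup H] [Module K H] [Module A H]
    [IsScalarTower K A H] (G : ℤ → Submodule K H)
    (hG : ∀ (i j : ℤ) (a : A) (f : H), a ∈ 𝒜 i → f ∈ G j → a • f ∈ G (i + j))
    (hind : iSupIndep G) : GrMod 𝒜 where
  carrier := Submodule.span A (⋃ d, (G d : Set H))
  gr d := (G d).comap ((Submodule.span A (⋃ d, (G d : Set H))).subtype.restrictScalars K)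
  smul_mem i j a m ha hm := hG i j a m.1 ha hm
  internal := by
    set P := Submodule.span A (⋃ d, (G d : Set H)) with hP
    set φ := P.subtype.restrictScalars K with hφ
    have hφi : Function.Injective φ := P.injective_subtype
    have hGP : ∀ d, (G d) ≤ LinearMap.range φ := by
      intro d x hx
      exact ⟨⟨x, Submodule.subset_span (Set.mem_iUnion.2 ⟨d, hx⟩)⟩, rfl⟩
    have hmap : ∀ d, ((G d).comap φ).map φ = G d := fun d =>
      Submodule.map_comap_eq_self (hGP d)
    refine DirectSum.isInternal_submodule_of_iSupIndep_of_iSup_eq_top ?_ ?_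
    · intro d
      rw [Submodule.disjoint_def]
      intro x hx hx'
      have h1 : φ x ∈ ⨆ (e) (_ : e ≠ d), G e := by
        have := Submodule.mem_map_of_mem (f := φ) hx'
        simp only [Submodule.map_iSup, hmap] at this
        exact this
      have := Submodule.disjoint_def.1 (hind d) (φ x) hx h1
      exact hφi (by simpa using this)
    · have hle : ∀ x ∈ P, x ∈ ⨆ d, G d := by
        intro x hx
        induction hx using Submodule.span_induction with
        | mem x hx =>
          obtain ⟨d, hd⟩ := Set.mem_iUnion.1 hx
          exact Submodule.mem_iSup_of_mem d hd
        | zero => exact Submodule.zero_mem _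
        | add x y _ _ hx hy => exact Submodule.add_mem _ hx hy
        | smul a x hx0 hx =>
          clear hx0
          induction hx using Submodule.iSup_induction' with
          | zero => rw [smul_zero]; exact Submodule.zero_mem _
          | add x y _ _ hx hy => rw [smul_add]; exact Submodule.add_mem _ hx hy
          | mem j x hx =>
            have ha : a ∈ ⨆ i, 𝒜 i := h𝒜 ▸ Submodule.mem_top
            induction ha using Submodule.iSup_induction' with
            | zero => rw [zero_smul]; exact Submodule.zero_mem _
            | add x y _ _ hx hy => rw [add_smul]; exact Submodule.add_mem _ hx hy
            | mem i a ha => exact Submodule.mem_iSup_of_mem (i + j) (hG i j a x ha hx)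
      refine eq_top_iff.2 fun x _ => ?_
      have h1 : φ x ∈ (⨆ d, (G d).comap φ).map φ := by
        simp only [Submodule.map_iSup, hmap]
        exact hle x.1 x.2
      obtain ⟨y, hy, hyx⟩ := h1
      exact hφi hyx ▸ hy

/-- An `A`-linear map sending `G d` to `G' d` for all `d` induces a morphism. -/
def ofPiecesMap (h𝒜 : ⨆ i, 𝒜 i = ⊤) {H H' : Type u} [AddCommGroup H] [Module K H] [Module A H]
    [IsScalarTower K A H] [AddCommGroup H'] [Module K H'] [Module A H'] [IsScalarTower K A H']
    {G : ℤ → Submodule K H} {G' : ℤ → Submodule K H'}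
    (hG : ∀ (i j : ℤ) (a : A) (f : H), a ∈ 𝒜 i → f ∈ G j → a • f ∈ G (i + j))
    (hind : iSupIndep G)
    (hG' : ∀ (i j : ℤ) (a : A) (f : H'), a ∈ 𝒜 i → f ∈ G' j → a • f ∈ G' (i + j))
    (hind' : iSupIndep G')
    (φ : H →ₗ[A] H') (hφ : ∀ (d : ℤ) (f : H), f ∈ G d → φ f ∈ G' d) :
    ofPieces h𝒜 H G hG hind ⟶ ofPieces h𝒜 H' G' hG' hind' :=
  ofLin (M := ofPieces h𝒜 H G hG hind) (N := ofPieces h𝒜 H' G' hG' hind')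
    (φ.restrict (p := Submodule.span A (⋃ d, (G d : Set H)))
      (q := Submodule.span A (⋃ d, (G' d : Set H'))) (by
        intro x hx
        have : Submodule.span A (⋃ d, (G d : Set H)) ≤
            (Submodule.span A (⋃ d, (G' d : Set H'))).comap φ := by
          refine Submodule.span_le.2 fun y hy => ?_
          obtain ⟨d, hd⟩ := Set.mem_iUnion.1 hy
          exact Submodule.subset_span (Set.mem_iUnion.2 ⟨d, hφ d y hd⟩)
        exact this hx))
    (fun d m hm => hφ d m.1 hm)

/-- Cochain maps inducing isomorphisms on all cohomology modules. -/
def quasiIso (𝒜 : ℤ → Submodule K A) : MorphismProperty (CochainComplex (GrMod 𝒜) ℤ) :=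
  fun _ _ f => QuasiIso (((forget 𝒜).mapHomologicalComplex (ComplexShape.up ℤ)).map f)

/-- The derived category `D(Gr A)`: the localization of the category of cochain complexes of
graded `A`-modules at the quasi-isomorphisms. -/
abbrev Derived (𝒜 : ℤ → Submodule K A) := (quasiIso 𝒜).Localization

/-- The functor from complexes to the derived category. -/
abbrev Derived.Q (𝒜 : ℤ → Submodule K A) : CochainComplex (GrMod 𝒜) ℤ ⥤ Derived 𝒜 :=
  (quasiIso 𝒜).Q

/-- Bounded complexes of finitely generated graded `A`-modules. -/
def boundedFG (𝒜 : ℤ → Submodule K A) : ObjectProperty (CochainComplex (GrMod 𝒜) ℤ) :=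
  fun N => (∃ a b : ℤ, ∀ i, i < a ∨ b < i → Limits.IsZero (N.X i)) ∧
    ∀ i, Module.Finite A (N.X i).carrier

/-- `I`, with the augmentation `η`, is a graded injective resolution of the complex `C`. -/
structure IsInjectiveResolution {C I : CochainComplex (GrMod 𝒜) ℤ} (η : C ⟶ I) : Prop where
  bounded_below : ∃ a : ℤ, ∀ i < a, Limits.IsZero (I.X i)
  injective : ∀ i, Injective (I.X i)
  quasi_iso : quasiIso 𝒜 η

end General

end GrMod

/-- A family of subspaces is independent if each one is complemented in the sum by a subspace
containing all the others. -/
theorem iSupIndep_of_separating {K H : Type u} [Field K] [AddCommMonoid H] [Module K H]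
    (G Z : ℤ → Submodule K H) (h1 : ∀ d e, e ≠ d → G e ≤ Z d)
    (h2 : ∀ d, ∀ x ∈ G d, x ∈ Z d → x = 0) : iSupIndep G := by
  intro d
  rw [Submodule.disjoint_def]
  intro x hx hx'
  exact h2 d x hx ((iSup₂_le fun e he => h1 d e he : (⨆ (e) (_ : e ≠ d), G e) ≤ Z d) hx')

/-- A linear map vanishing on all homogeneous elements is zero. -/
theorem GrMod.eq_zero_of_homogeneous {K A : Type u} [Field K] [Ring A] [Algebra K A]
    {𝒜 : ℤ → Submodule K A} (M : GrMod 𝒜) {N : Type u} [AddCommGroup N] (f : M.carrier →+ N)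
    (hf : ∀ i, ∀ z ∈ M.gr i, f z = 0) : f = 0 := by
  ext z
  have hz : z ∈ ⨆ i, M.gr i := by
    rw [M.internal.submodule_iSup_eq_top]
    trivial
  induction hz using Submodule.iSup_induction' with
  | zero => simp
  | add x y _ _ hx hy => rw [map_add, hx, hy]; simp
  | mem i z hz => exact hf i z hz

section HomComplex

open GrMod

variable {K S : Type u} [Field K] [CommRing S] [Algebra K S] {𝒮 : ℤ → Submodule K S}

/-- The complex of ungraded modules underlying a complex of graded modules. -/
abbrev GrMod.under (M : CochainComplex (GrMod 𝒮) ℤ) : CochainComplex (ModuleCat.{u} S) ℤ :=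
  ((forget 𝒮).mapHomologicalComplex (ComplexShape.up ℤ)).obj M

/-- The chain map of ungraded modules underlying a morphism. -/
abbrev GrMod.underMap {M N : CochainComplex (GrMod 𝒮) ℤ} (f : M ⟶ N) : under M ⟶ under N :=
  ((forget 𝒮).mapHomologicalComplex (ComplexShape.up ℤ)).map f

instance (F G : CochainComplex (ModuleCat.{u} S) ℤ) (m : ℤ) :
    IsScalarTower K S (Cochain F G m) where
  smul_assoc k s z := by
    refine Cochain.ext _ _ fun p q hpq => ?_
    rw [Cochain.smul_v, Cochain.smul_v, Cochain.smul_v]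
    ext x
    change (k • s) • ((z.v p q hpq).hom x) = algebraMap K S k • (s • ((z.v p q hpq).hom x))
    rw [Algebra.smul_def, mul_smul]

/-- The component `M^p → I^q` of a cochain of degree `m = q - p`, as a linear map. -/
def GrMod.value {M I : CochainComplex (GrMod 𝒮) ℤ} {m : ℤ} (f : Cochain (under M) (under I) m)
    (p q : ℤ) (hpq : p + m = q) : (M.X p).carrier →ₗ[S] (I.X q).carrier :=
  (f.v p q hpq).hom

/-- The cochains `f` of cohomological degree `m` from `M` to `I` that are homogeneous of internal
degree `d`, i.e. `f (M^p_i) ⊆ I^{p+m}_{i+d}`. -/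
def GrMod.homPiece (M I : CochainComplex (GrMod 𝒮) ℤ) (m d : ℤ) :
    Submodule K (Cochain (under M) (under I) m) where
  carrier := {f | ∀ (p q : ℤ) (hpq : p + m = q) (i : ℤ) (z : (M.X p).carrier),
    z ∈ (M.X p).gr i → value f p q hpq z ∈ (I.X q).gr (i + d)}
  zero_mem' _ q _ i _ _ := ((I.X q).gr (i + d)).zero_mem
  add_mem' hf hg p q hpq i z hz := ((I.X q).gr (i + d)).add_mem (hf p q hpq i z hz)
    (hg p q hpq i z hz)
  smul_mem' k f hf p q hpq i z hz := by
    have h : value (k • f) p q hpq z = k • value f p q hpq z := by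
      change algebraMap K S k • value f p q hpq z = _
      rw [algebraMap_smul]
    rw [h]
    exact ((I.X q).gr (i + d)).smul_mem k (hf p q hpq i z hz)

theorem GrMod.homPiece_smul_mem (M I : CochainComplex (GrMod 𝒮) ℤ) (m i j : ℤ) (a : S)
    (f : Cochain (under M) (under I) m) (ha : a ∈ 𝒮 i) (hf : f ∈ homPiece M I m j) :
    a • f ∈ homPiece M I m (i + j) := by
  intro p q hpq t z hz
  have h := (I.X q).smul_mem i (t + j) a _ ha (hf p q hpq t z hz)
  rw [show t + (i + j) = i + (t + j) by ring]
  exact h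

theorem GrMod.homPiece_iSupIndep (M I : CochainComplex (GrMod 𝒮) ℤ) (m : ℤ) :
    iSupIndep (homPiece M I m) := by
  intro d
  rw [Submodule.disjoint_def]
  intro f hf hf'
  have key : ∀ (p q : ℤ) (hpq : p + m = q) (i : ℤ) (z : (M.X p).carrier), z ∈ (M.X p).gr i →
      value f p q hpq z ∈ ⨆ (e) (_ : e ≠ i + d), (I.X q).gr e := by
    intro p q hpq i z hz
    let ev : Cochain (under M) (under I) m →ₗ[K] (I.X q).carrier :=
      { toFun := fun g => value g p q hpq z
        map_add' := fun _ _ => rfl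
        map_smul' := fun k g => by
          change algebraMap K S k • value g p q hpq z = _
          rw [algebraMap_smul]; rfl }
    have hle : (⨆ (e) (_ : e ≠ d), homPiece M I m e) ≤
        (⨆ (e) (_ : e ≠ i + d), (I.X q).gr e).comap ev := by
      refine iSup₂_le fun e he g hg => ?_
      have hne : i + e ≠ i + d := fun h => he (add_left_cancel h)
      exact Submodule.mem_iSup_of_mem (i + e)
        (Submodule.mem_iSup_of_mem hne (hg p q hpq i z hz))
    exact hle hf'
  have hz : ∀ (p q : ℤ) (hpq : p + m = q), value f p q hpq = 0 := by
    intro p q hpq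
    have h := (M.X p).eq_zero_of_homogeneous (value f p q hpq).toAddMonoidHom (fun i z hz =>
      Submodule.disjoint_def.1 ((I.X q).internal.submodule_iSupIndep (i + d)) _
        (hf p q hpq i z hz) (key p q hpq i z hz))
    ext x
    exact DFunLike.congr_fun h x
  refine Cochain.ext _ _ fun p q hpq => ?_
  exact ModuleCat.hom_ext (hz p q hpq)

variable (h𝒮 : ⨆ i, 𝒮 i = ⊤)

/-- The term of cohomological degree `m` of `Hom•(M, I)`: the graded `S`-module of all sums of
homogeneous families of `S`-linear maps `M^p → I^{p+m}`.  If `M` is a bounded complex of finitely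
generated modules, these are all families of `S`-linear maps. -/
def GrMod.homTerm (M I : CochainComplex (GrMod 𝒮) ℤ) (m : ℤ) : GrMod 𝒮 :=
  ofPieces h𝒮 (Cochain (under M) (under I) m) (homPiece M I m)
    (homPiece_smul_mem M I m) (homPiece_iSupIndep M I m)

theorem GrMod.δ_mem_homPiece (M I : CochainComplex (GrMod 𝒮) ℤ) (m m' d : ℤ)
    (f : Cochain (under M) (under I) m) (hf : f ∈ homPiece M I m d) :
    δ m m' f ∈ homPiece M I m' d := by
  by_cases hm : m + 1 = m'
  · intro p q hpq i z hz
    have h : value (δ m m' f) p q hpq z =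
        toLin (I.d (q - 1) q) (value f p (q - 1) (by lia) z) +
          m'.negOnePow • value f (p + 1) q (by lia) (toLin (M.d p (p + 1)) z) := by
      change ((δ m m' f).v p q hpq).hom z = _
      rw [δ_v m m' hm f p q hpq (q - 1) (p + 1) rfl rfl]
      rfl
    rw [h]
    refine Submodule.add_mem _ (toLin_mem _ (hf _ _ _ _ _ hz)) ?_
    have h2 := hf (p + 1) q (by lia) i _ (toLin_mem (M.d p (p + 1)) hz)
    rcases Int.even_or_odd m' with he | ho
    · rw [Int.negOnePow_even _ he, one_smul]
      exact h2
    · rw [Int.negOnePow_odd _ ho, Units.neg_smul, one_smul]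
      exact Submodule.neg_mem _ h2
  · rw [δ_shape _ _ hm]
    exact Submodule.zero_mem _

/-- The complex `Hom•(M, I)` of graded `S`-modules, with the usual differential
`f ↦ d_I ∘ f - (-1)^m f ∘ d_M` on cochains of degree `m`. -/
def GrMod.homComplex (M I : CochainComplex (GrMod 𝒮) ℤ) : CochainComplex (GrMod 𝒮) ℤ where
  X m := homTerm h𝒮 M I m
  d m m' := ofPiecesMap h𝒮 (homPiece_smul_mem M I m) (homPiece_iSupIndep M I m)
    (homPiece_smul_mem M I m') (homPiece_iSupIndep M I m') (δ_hom S (under M) (under I) m m')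
    (δ_mem_homPiece M I m m')
  shape m m' h := by
    refine hom_ext (LinearMap.ext fun f => Subtype.ext ?_)
    exact δ_shape m m' h f.1
  d_comp_d' m m' m'' _ _ := by
    refine hom_ext (LinearMap.ext fun f => Subtype.ext ?_)
    exact δ_δ m m' m'' f.1

theorem GrMod.comp_mem_homPiece {M N : CochainComplex (GrMod 𝒮) ℤ} (g : M ⟶ N)
    (I : CochainComplex (GrMod 𝒮) ℤ) (m d : ℤ)
    (f : Cochain (under N) (under I) m) (hf : f ∈ homPiece N I m d) :
    (Cochain.ofHom (underMap g)).comp f (zero_add m) ∈ homPiece M I m d := by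
  intro p q hpq i z hz
  have h : value ((Cochain.ofHom (underMap g)).comp f (zero_add m)) p q hpq z =
      value f p q hpq (toLin (g.f p) z) := by
    change (((Cochain.ofHom (underMap g)).comp f (zero_add m)).v p q hpq).hom z = _
    rw [Cochain.zero_cochain_comp_v, Cochain.ofHom_v]
    rfl
  rw [h]
  exact hf p q hpq i _ (toLin_mem (g.f p) hz)

/-- Precomposition with a chain map, on `Hom•(-, I)`. -/
def GrMod.homComplexMap {M N : CochainComplex (GrMod 𝒮) ℤ} (g : M ⟶ N)
    (I : CochainComplex (GrMod 𝒮) ℤ) : homComplex h𝒮 N I ⟶ homComplex h𝒮 M I where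
  f m := ofPiecesMap h𝒮 (homPiece_smul_mem N I m) (homPiece_iSupIndep N I m)
    (homPiece_smul_mem M I m) (homPiece_iSupIndep M I m)
    { toFun := fun f => (Cochain.ofHom (underMap g)).comp f (zero_add m)
      map_add' := fun _ _ => Cochain.comp_add _ _ _ _
      map_smul' := fun _ _ => Cochain.comp_smul _ _ _ _ }
    (comp_mem_homPiece g I m)
  comm' m m' _ := by
    refine hom_ext (LinearMap.ext fun f => Subtype.ext ?_)
    exact δ_ofHom_comp (underMap g) f.1 m'

/-- The contravariant functor `Hom•(-, I)` on complexes of graded `S`-modules. -/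
def GrMod.homFunctor (I : CochainComplex (GrMod 𝒮) ℤ) :
    (CochainComplex (GrMod 𝒮) ℤ)ᵒᵖ ⥤ CochainComplex (GrMod 𝒮) ℤ where
  obj M := homComplex h𝒮 M.unop I
  map g := homComplexMap h𝒮 g.unop I
  map_id M := by
    ext m : 1
    refine hom_ext (LinearMap.ext fun f => Subtype.ext ?_)
    change (Cochain.ofHom (underMap (𝟙 M.unop))).comp f.1 (zero_add m) = f.1
    rw [underMap, CategoryTheory.Functor.map_id, Cochain.id_comp]
  map_comp {M N P} g g' := by
    ext m : 1
    refine hom_ext (LinearMap.ext fun f => Subtype.ext ?_)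
    change (Cochain.ofHom (underMap (g'.unop ≫ g.unop))).comp f.1 (zero_add m) =
      (Cochain.ofHom (underMap g'.unop)).comp
        ((Cochain.ofHom (underMap g.unop)).comp f.1 (zero_add m)) (zero_add m)
    rw [underMap, CategoryTheory.Functor.map_comp, Cochain.ofHom_comp]
    exact Cochain.comp_assoc_of_first_is_zero_cochain _ _ _ _

end HomComplex

/-! ### The polynomial ring and the exterior algebra -/

/-- `S = K[x_1, …, x_n]`. -/
abbrev PolyAlg (n : ℕ) (K : Type u) [Field K] : Type u := MvPolynomial (Fin n) K

/-- The exterior algebra `E = K⟨y_1, …, y_n⟩`. -/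
abbrev ExtAlg (n : ℕ) (K : Type u) [Field K] : Type u := ExteriorAlgebra K (Fin n → K)

section Rings

variable (n : ℕ) (K : Type u) [Field K]

/-- The generator `y_l` of `E`. -/
def extY (l : Fin n) : ExtAlg n K := ExteriorAlgebra.ι K (Pi.single l 1)

/-- The grading of `S` with `deg x_l = 1`, indexed by `ℤ`. -/
def symGr (i : ℤ) : Submodule K (PolyAlg n K) :=
  MvPolynomial.weightedHomogeneousSubmodule K (fun _ : Fin n => (1 : ℤ)) i

/-- The grading of `E` with `E_{-i} = ⋀^i`, so that `deg y_l = -1`. -/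
def extGr (i : ℤ) : Submodule K (ExtAlg n K) :=
  if i ≤ 0 then ⋀[K]^((-i).toNat) (Fin n → K) else ⊥

instance : SetLike.GradedMonoid (symGr n K) :=
  MvPolynomial.WeightedHomogeneousSubmodule.gradedMonoid

theorem symGr_iSup : ⨆ i, symGr n K i = ⊤ := by
  refine eq_top_iff.2 fun p _ => ?_
  rw [← MvPolynomial.sum_weightedHomogeneousComponent (fun _ : Fin n => (1 : ℤ)) p]
  refine finsum_induction (· ∈ ⨆ i, symGr n K i) (Submodule.zero_mem _)
    (fun _ _ hx hy => Submodule.add_mem _ hx hy) fun i => ?_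
  exact Submodule.mem_iSup_of_mem i (MvPolynomial.weightedHomogeneousComponent_mem _ p i)

theorem symGr_isInternal : DirectSum.IsInternal (symGr n K) := by
  refine DirectSum.isInternal_submodule_of_iSupIndep_of_iSup_eq_top ?_ (symGr_iSup n K)
  refine iSupIndep_of_separating _
    (fun d => LinearMap.ker (MvPolynomial.weightedHomogeneousComponent
      (fun _ : Fin n => (1 : ℤ)) d)) ?_ ?_
  · intro d e hed p hp
    exact MvPolynomial.IsWeightedHomogeneous.weightedHomogeneousComponent_ne d hp hed.symm
  · intro d p hp hp'
    rw [← MvPolynomial.IsWeightedHomogeneous.weightedHomogeneousComponent_same hp]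
    exact hp'

theorem extGr_neg (k : ℕ) : extGr n K (-(k : ℤ)) = ⋀[K]^k (Fin n → K) := by
  simp [extGr]

theorem extGr_eq (i : ℤ) : (∃ k : ℕ, i = -(k : ℤ)) ∨ extGr n K i = ⊥ := by
  by_cases h : i ≤ 0
  · exact Or.inl ⟨(-i).toNat, by lia⟩
  · exact Or.inr (if_neg h)

instance : SetLike.GradedMonoid (extGr n K) where
  one_mem := by
    have h := extGr_neg n K 0
    rw [Nat.cast_zero, neg_zero] at h
    rw [h]
    exact SetLike.GradedOne.one_mem
  mul_mem i j a b ha hb := by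
    rcases extGr_eq n K i with ⟨k, rfl⟩ | hi
    · rcases extGr_eq n K j with ⟨m, rfl⟩ | hj
      · rw [extGr_neg] at ha hb
        rw [← neg_add, ← Nat.cast_add, extGr_neg]
        exact SetLike.mul_mem_graded (A := fun i : ℕ => ⋀[K]^i (Fin n → K)) ha hb
      · rw [hj, Submodule.mem_bot] at hb
        rw [hb, mul_zero]
        exact Submodule.zero_mem _
    · rw [hi, Submodule.mem_bot] at ha
      rw [ha, zero_mul]
      exact Submodule.zero_mem _

theorem extGr_isInternal : DirectSum.IsInternal (extGr n K) := by
  have h := DirectSum.Decomposition.isInternal (fun i : ℕ => ⋀[K]^i (Fin n → K))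
  rw [DirectSum.isInternal_submodule_iff_iSupIndep_and_iSup_eq_top] at h ⊢
  constructor
  · intro i
    rcases extGr_eq n K i with ⟨k, rfl⟩ | hi
    · rw [extGr_neg]
      refine (h.1 k).mono_right (iSup₂_le fun e he => ?_)
      rcases extGr_eq n K e with ⟨m, rfl⟩ | hj
      · rw [extGr_neg]
        exact le_iSup₂_of_le m (fun h => he (by rw [h])) le_rfl
      · rw [hj]
        exact bot_le
    · rw [hi]
      exact disjoint_bot_left
  · rw [eq_top_iff, ← h.2]
    refine iSup_le fun k => ?_
    rw [← extGr_neg]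
    exact le_iSup (extGr n K) _

theorem extGr_iSup : ⨆ i, extGr n K i = ⊤ := (extGr_isInternal n K).submodule_iSup_eq_top

theorem extY_mem (l : Fin n) : extY n K l ∈ extGr n K (-1) := by
  have h := extGr_neg n K 1
  rw [Nat.cast_one] at h
  rw [h]
  change _ ∈ (LinearMap.range (ExteriorAlgebra.ι K : (Fin n → K) →ₗ[K] ExtAlg n K)) ^ 1
  rw [pow_one]
  exact LinearMap.mem_range_self _ _

theorem extY_mul_self (l : Fin n) : extY n K l * extY n K l = 0 :=
  ExteriorAlgebra.ι_sq_zero _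

theorem extY_mul_comm (k l : Fin n) :
    extY n K k * extY n K l = -(extY n K l * extY n K k) :=
  eq_neg_of_add_eq_zero_left (ExteriorAlgebra.ι_add_mul_swap _ _)

/-- `S` as a graded `S`-module. -/
def symMod : GrMod (symGr n K) := GrMod.self (symGr n K) (symGr_isInternal n K)

/-- The complex `S(-n)[n]`: the twist `S(-n)` in cohomological degree `-n`. -/
def canonicalComplex : CochainComplex (GrMod (symGr n K)) ℤ :=
  (shiftFunctor (CochainComplex (GrMod (symGr n K)) ℤ) (n : ℤ)).obj
    ((HomologicalComplex.single (GrMod (symGr n K)) (ComplexShape.up ℤ) 0).obj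
      ((GrMod.twist (symGr n K) (-(n : ℤ))).obj (symMod n K)))

end Rings

/-! ### The duality on the exterior side -/

section ExtDual

open GrMod

variable {n : ℕ} {K : Type u} [Field K]

/-- Every graded left `E`-module is a right `E`-module through `z e = (-1)^{deg e deg z} e z` for
homogeneous `e`, `z`.  The predicate says that `f : N → E` is linear for the right actions. -/
def IsRightLinear (N : GrMod (extGr n K)) (f : N.carrier →ₗ[K] ExtAlg n K) : Prop :=
  ∀ (i j : ℤ) (e : ExtAlg n K) (z : N.carrier), e ∈ extGr n K i → z ∈ N.gr j →
    f ((i * j).negOnePow • (e • z)) = f z * e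

/-- `Hom_E(N, E)_d`: the right `E`-linear maps `f : N → E` with `f(N_j) ⊆ E_{j+d}`. -/
def dualPiece (N : GrMod (extGr n K)) (d : ℤ) : Submodule K (N.carrier →ₗ[K] ExtAlg n K) where
  carrier := {f | IsRightLinear N f ∧ ∀ (j : ℤ) (z : N.carrier), z ∈ N.gr j →
    f z ∈ extGr n K (j + d)}
  zero_mem' := ⟨fun _ _ _ _ _ _ => by simp, fun _ _ _ => Submodule.zero_mem _⟩
  add_mem' hf hg := ⟨fun i j e z he hz => by
      rw [LinearMap.add_apply, LinearMap.add_apply, hf.1 i j e z he hz, hg.1 i j e z he hz, add_mul],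
    fun j z hz => Submodule.add_mem _ (hf.2 j z hz) (hg.2 j z hz)⟩
  smul_mem' k f hf := ⟨fun i j e z he hz => by
      rw [LinearMap.smul_apply, LinearMap.smul_apply, hf.1 i j e z he hz, smul_mul_assoc],
    fun j z hz => Submodule.smul_mem _ k (hf.2 j z hz)⟩

theorem dualPiece_smul_mem (N : GrMod (extGr n K)) (i j : ℤ) (a : ExtAlg n K)
    (f : N.carrier →ₗ[K] ExtAlg n K) (ha : a ∈ extGr n K i) (hf : f ∈ dualPiece N j) :
    a • f ∈ dualPiece N (i + j) := by
  refine ⟨fun p q e z he hz => ?_, fun q z hz => ?_⟩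
  · rw [LinearMap.smul_apply, LinearMap.smul_apply, hf.1 p q e z he hz, smul_mul_assoc]
  · rw [show q + (i + j) = i + (q + j) by ring]
    exact SetLike.mul_mem_graded ha (hf.2 q z hz)

theorem dualPiece_iSupIndep (N : GrMod (extGr n K)) : iSupIndep (dualPiece N) := by
  refine iSupIndep_of_separating _ (fun d => ⨅ (j : ℤ) (z : N.gr j),
    (⨆ (e) (_ : e ≠ j + d), extGr n K e).comap (LinearMap.applyₗ (z : N.carrier))) ?_ ?_
  · intro d e hed f hf
    simp only [Submodule.mem_iInf]
    intro j z
    exact Submodule.mem_iSup_of_mem (j + e)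
      (Submodule.mem_iSup_of_mem (fun h => hed (add_left_cancel h)) (hf.2 j z z.2))
  · intro d f hf hf'
    simp only [Submodule.mem_iInf] at hf'
    have h := N.eq_zero_of_homogeneous f.toAddMonoidHom (fun j z hz =>
      Submodule.disjoint_def.1 ((extGr_isInternal n K).submodule_iSupIndep (j + d)) _
        (hf.2 j z hz) (hf' j ⟨z, hz⟩))
    ext x
    exact DFunLike.congr_fun h x

/-- The graded `E`-module `N^* = Hom_E(N, E) = ⨁_d Hom_E(N, E)_d`, with `(a f)(z) = a f(z)`.  If
`N` is finitely generated, it consists of all right `E`-linear maps `N → E`. -/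
def dualMod (N : GrMod (extGr n K)) : GrMod (extGr n K) :=
  ofPieces (extGr_iSup n K) (N.carrier →ₗ[K] ExtAlg n K) (dualPiece N)
    (dualPiece_smul_mem N) (dualPiece_iSupIndep N)

/-- The transpose `f ↦ f ∘ g` of a morphism. -/
def dualMap {M N : GrMod (extGr n K)} (g : M ⟶ N) : dualMod N ⟶ dualMod M :=
  ofPiecesMap (extGr_iSup n K) (dualPiece_smul_mem N) (dualPiece_iSupIndep N)
    (dualPiece_smul_mem M) (dualPiece_iSupIndep M)
    { toFun := fun f => f ∘ₗ (toLin g).restrictScalars K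
      map_add' := fun _ _ => rfl
      map_smul' := fun _ _ => rfl }
    (fun d f hf => ⟨fun i j e z he hz => by
        have h := hf.1 i j e (toLin g z) he (toLin_mem g hz)
        change f (toLin g ((i * j).negOnePow • (e • z))) = f (toLin g z) * e
        rw [← h, ← map_smul (toLin g) e z]
        rcases Int.even_or_odd (i * j) with he | ho
        · rw [Int.negOnePow_even _ he, one_smul, one_smul]
        · rw [Int.negOnePow_odd _ ho, Units.neg_smul, one_smul, Units.neg_smul, one_smul, map_neg],
      fun j z hz => hf.2 j _ (toLin_mem g hz)⟩)

theorem dualMap_apply {M N : GrMod (extGr n K)} (g : M ⟶ N) (u : ℤˣ) (f : (dualMod N).carrier)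
    (z : M.carrier) : (toLin (u • dualMap g) f).1 z = u • f.1 (toLin g z) := rfl

/-- The complex `D_E(N) = Hom_E(N, E)`, with `D_E(N)^i = (N^{-i})^*` and the differential
`f ↦ (-1)^{i+1} f ∘ d_N` on `D_E(N)^i`. -/
def extDualObj (N : CochainComplex (GrMod (extGr n K)) ℤ) :
    CochainComplex (GrMod (extGr n K)) ℤ where
  X i := dualMod (N.X (-i))
  d i j := j.negOnePow • dualMap (N.d (-j) (-i))
  shape i j h := by
    have h0 : N.d (-j) (-i) = 0 := N.shape _ _ (fun h' => h (by simp at h' ⊢; lia))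
    rw [h0]
    refine hom_ext (LinearMap.ext fun f => Subtype.ext (LinearMap.ext fun z => ?_))
    refine (dualMap_apply _ _ f z).trans ?_
    rw [toLin_zero, LinearMap.zero_apply, map_zero, smul_zero]
    rfl
  d_comp_d' i j k _ _ := by
    refine hom_ext (LinearMap.ext fun f => Subtype.ext (LinearMap.ext fun z => ?_))
    change k.negOnePow • j.negOnePow •
      f.1 ((toLin (N.d (-j) (-i)) ∘ₗ toLin (N.d (-k) (-j))) z) = 0
    rw [← toLin_comp, N.d_comp_d, toLin_zero, LinearMap.zero_apply, map_zero, smul_zero,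
      smul_zero]

/-- The contravariant functor `D_E` on complexes of graded `E`-modules. -/
def extDual (n : ℕ) (K : Type u) [Field K] :
    (CochainComplex (GrMod (extGr n K)) ℤ)ᵒᵖ ⥤ CochainComplex (GrMod (extGr n K)) ℤ where
  obj N := extDualObj N.unop
  map {M N} g :=
    { f := fun i => dualMap (g.unop.f (-i))
      comm' := fun i j _ => by
        refine hom_ext (LinearMap.ext fun f => Subtype.ext (LinearMap.ext fun z => ?_))
        change j.negOnePow • f.1 ((toLin (g.unop.f (-i)) ∘ₗ toLin (N.unop.d (-j) (-i))) z) =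
          j.negOnePow • f.1 ((toLin (M.unop.d (-j) (-i)) ∘ₗ toLin (g.unop.f (-j))) z)
        rw [← toLin_comp, ← toLin_comp, g.unop.comm] }
  map_id _ := rfl
  map_comp _ _ := rfl

end ExtDual

/-! ### The functor `L` -/

section BGG

open GrMod

variable {n : ℕ} {K : Type u} [Field K]

section Free

variable (V : ℤ → Type u) [∀ i, AddCommGroup (V i)] [∀ i, Module K (V i)] (w : ℤ → ℤ)

/-- The part of degree `d` of `S ⊗ ⨁_i V_i` when `1 ⊗ v` has degree `w i` for `v ∈ V_i`:
it is `⨁_i S_{d - w i} ⊗ V_i`. -/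
def freePiece (d : ℤ) : Submodule K (PolyAlg n K ⊗[K] (⨁ i, V i)) :=
  Submodule.span K {t | ∃ i : ℤ, ∃ s ∈ symGr n K (d - w i), ∃ v : V i,
    s ⊗ₜ[K] DirectSum.lof K ℤ V i v = t}

theorem tmul_mem_freePiece {d i : ℤ} {s : PolyAlg n K} (hs : s ∈ symGr n K (d - w i)) (v : V i) :
    s ⊗ₜ[K] DirectSum.lof K ℤ V i v ∈ freePiece V w d :=
  Submodule.subset_span ⟨i, s, hs, v, rfl⟩

theorem freePiece_smul_mem (a d : ℤ) (s : PolyAlg n K) (t : PolyAlg n K ⊗[K] (⨁ i, V i))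
    (hs : s ∈ symGr n K a) (ht : t ∈ freePiece V w d) : s • t ∈ freePiece V w (a + d) := by
  induction ht using Submodule.span_induction with
  | mem t ht =>
    obtain ⟨i, s', hs', v, rfl⟩ := ht
    rw [TensorProduct.smul_tmul']
    refine tmul_mem_freePiece V w ?_ v
    rw [add_sub_assoc]
    exact SetLike.mul_mem_graded hs hs'
  | zero => rw [smul_zero]; exact Submodule.zero_mem _
  | add x y _ _ hx hy => rw [smul_add]; exact Submodule.add_mem _ hx hy
  | smul k x _ hx => rw [smul_comm]; exact Submodule.smul_mem _ k hx

/-- The projection `S ⊗ ⨁_i V_i → ⨁_i S_{d - w i} ⊗ V_i`. -/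
def freeProj (d : ℤ) : PolyAlg n K ⊗[K] (⨁ i, V i) →ₗ[K] PolyAlg n K ⊗[K] (⨁ i, V i) :=
  TensorProduct.lift (LinearMap.flip (DirectSum.toModule K ℤ
    (PolyAlg n K →ₗ[K] PolyAlg n K ⊗[K] (⨁ i, V i)) fun i =>
      LinearMap.flip ((TensorProduct.mk K (PolyAlg n K) (⨁ i, V i)).compl₁₂
        (MvPolynomial.weightedHomogeneousComponent (fun _ : Fin n => (1 : ℤ)) (d - w i))
        (DirectSum.lof K ℤ V i))))

theorem freeProj_tmul (d i : ℤ) (s : PolyAlg n K) (v : V i) :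
    freeProj V w d (s ⊗ₜ[K] DirectSum.lof K ℤ V i v) =
      MvPolynomial.weightedHomogeneousComponent (fun _ : Fin n => (1 : ℤ)) (d - w i) s ⊗ₜ[K]
        DirectSum.lof K ℤ V i v := by
  rw [freeProj, TensorProduct.lift.tmul, LinearMap.flip_apply, DirectSum.toModule_lof]
  rfl

theorem freePiece_iSupIndep : iSupIndep (freePiece (n := n) (K := K) V w) := by
  refine iSupIndep_of_separating _ (fun d => LinearMap.ker (freeProj V w d)) ?_ ?_
  · intro d e hed
    refine Submodule.span_le.2 ?_
    rintro _ ⟨i, s, hs, v, rfl⟩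
    refine LinearMap.mem_ker.2 ?_
    rw [freeProj_tmul, MvPolynomial.IsWeightedHomogeneous.weightedHomogeneousComponent_ne
      (d - w i) hs (fun h => hed (sub_left_injective h).symm), TensorProduct.zero_tmul]
  · intro d t ht ht'
    rw [LinearMap.mem_ker] at ht'
    rw [← ht']
    clear ht'
    induction ht using Submodule.span_induction with
    | mem t ht =>
      obtain ⟨i, s, hs, v, rfl⟩ := ht
      rw [freeProj_tmul,
        MvPolynomial.IsWeightedHomogeneous.weightedHomogeneousComponent_same hs]
    | zero => rw [map_zero]
    | add x y _ _ hx hy => rw [map_add, ← hx, ← hy]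
    | smul k x _ hx => rw [map_smul, ← hx]

theorem freePiece_iSup : ⨆ d, freePiece (n := n) (K := K) V w d = ⊤ := by
  refine eq_top_iff.2 fun t _ => ?_
  induction t with
  | zero => exact Submodule.zero_mem _
  | add x y hx hy => exact Submodule.add_mem _ (hx trivial) (hy trivial)
  | tmul s v =>
    induction v using DirectSum.induction_on with
    | zero => rw [TensorProduct.tmul_zero]; exact Submodule.zero_mem _
    | add x y hx hy =>
      rw [TensorProduct.tmul_add]; exact Submodule.add_mem _ (hx trivial) (hy trivial)
    | of i v =>
      have hs : s ∈ ⨆ a, symGr n K a := symGr_iSup n K ▸ Submodule.mem_top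
      induction hs using Submodule.iSup_induction' with
      | zero => rw [TensorProduct.zero_tmul]; exact Submodule.zero_mem _
      | add x y _ _ hx hy =>
        rw [TensorProduct.add_tmul]; exact Submodule.add_mem _ (hx trivial) (hy trivial)
      | mem a s hs =>
        refine Submodule.mem_iSup_of_mem (a + w i) (tmul_mem_freePiece V w ?_ v)
        rwa [add_sub_cancel_right]

/-- The graded free `S`-module `⨁_i S ⊗ V_i` with `s ⊗ v` in degree `deg s + w i` for `v ∈ V_i`. -/
def freeMod (n : ℕ) : GrMod (symGr n K) where
  carrier := PolyAlg n K ⊗[K] (⨁ i, V i)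
  gr := freePiece V w
  smul_mem := freePiece_smul_mem V w
  internal := DirectSum.isInternal_submodule_of_iSupIndep_of_iSup_eq_top
    (freePiece_iSupIndep V w) (freePiece_iSup V w)

/-- Linear maps out of `S ⊗ ⨁_i V_i` agree if they agree on the `1 ⊗ v`, `v ∈ V_i`. -/
theorem freeMod_lin_ext {P : Type u} [AddCommGroup P] [Module (PolyAlg n K) P]
    {φ ψ : PolyAlg n K ⊗[K] (⨁ i, V i) →ₗ[PolyAlg n K] P}
    (h : ∀ i (v : V i), φ (1 ⊗ₜ[K] DirectSum.lof K ℤ V i v) =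
      ψ (1 ⊗ₜ[K] DirectSum.lof K ℤ V i v)) : φ = ψ := by
  refine LinearMap.ext fun t => ?_
  induction t with
  | zero => rw [map_zero, map_zero]
  | add x y hx hy => rw [map_add, map_add, hx, hy]
  | tmul s v =>
    have hs : s ⊗ₜ[K] v = s • ((1 : PolyAlg n K) ⊗ₜ[K] v) := by
      rw [TensorProduct.smul_tmul', smul_eq_mul, mul_one]
    rw [hs, map_smul, map_smul]
    congr 1
    induction v using DirectSum.induction_on with
    | zero => rw [TensorProduct.tmul_zero, map_zero, map_zero]
    | add x y hx hy =>
      rw [TensorProduct.tmul_add, map_add, map_add, hx (by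
        rw [TensorProduct.smul_tmul', smul_eq_mul, mul_one]), hy (by
        rw [TensorProduct.smul_tmul', smul_eq_mul, mul_one])]
    | of i v => exact h i v

/-- An `S`-linear map that sends `1 ⊗ V_i` into degree `w i` is degree-preserving. -/
theorem freeMod_map_mem (P : GrMod (symGr n K))
    (φ : PolyAlg n K ⊗[K] (⨁ i, V i) →ₗ[PolyAlg n K] P.carrier)
    (h : ∀ i (v : V i), φ (1 ⊗ₜ[K] DirectSum.lof K ℤ V i v) ∈ P.gr (w i)) (d : ℤ)
    (t : PolyAlg n K ⊗[K] (⨁ i, V i)) (ht : t ∈ freePiece V w d) : φ t ∈ P.gr d := by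
  have hle : freePiece V w d ≤ (P.gr d).comap (φ.restrictScalars K) := by
    refine Submodule.span_le.2 ?_
    rintro _ ⟨i, s, hs, v, rfl⟩
    have hs' : s ⊗ₜ[K] DirectSum.lof K ℤ V i v =
        s • ((1 : PolyAlg n K) ⊗ₜ[K] DirectSum.lof K ℤ V i v) := by
      rw [TensorProduct.smul_tmul', smul_eq_mul, mul_one]
    have h1 := P.smul_mem (d - w i) (w i) s _ hs (h i v)
    rw [sub_add_cancel, ← map_smul, ← hs'] at h1
    exact h1
  exact hle ht

end Free

/-- Multiplication by `y_l` as a map `N_j → N_{j'}`, `j' = j - 1`. -/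
def yAct (N : GrMod (extGr n K)) (l : Fin n) (j j' : ℤ) (h : j = j' + 1) :
    N.gr j →ₗ[K] N.gr j' :=
  (Algebra.lsmul K K N.carrier (extY n K l)).restrict (p := N.gr j) (q := N.gr j') fun z hz => by
    have := N.smul_mem (-1) j _ z (extY_mem n K l) hz
    rwa [h, neg_add_cancel_comm_assoc] at this

/-- The part of degree `j` of a morphism. -/
def grMap {M N : GrMod (extGr n K)} (g : M ⟶ N) (j j' : ℤ) (h : j = j') :
    M.gr j →ₗ[K] N.gr j' :=
  ((toLin g).restrictScalars K).restrict (p := M.gr j) (q := N.gr j') fun _ hz =>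
    h ▸ toLin_mem g hz

section Koszul

variable {V V' V'' W W' : Type u} [AddCommMonoid V] [Module K V] [AddCommMonoid V'] [Module K V']
  [AddCommMonoid V''] [Module K V''] [AddCommMonoid W] [Module K W] [AddCommMonoid W'] [Module K W']

/-- The `S`-linear map `s ⊗ v ↦ ∑_l x_l s ⊗ Y_l v + s ⊗ D v`. -/
def koszulD (Y : Fin n → V →ₗ[K] V') (D : V →ₗ[K] V') :
    PolyAlg n K ⊗[K] V →ₗ[PolyAlg n K] PolyAlg n K ⊗[K] V' :=
  ∑ l : Fin n, (MvPolynomial.X l : PolyAlg n K) • (Y l).baseChange (PolyAlg n K) +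
    D.baseChange (PolyAlg n K)

theorem koszulD_tmul (Y : Fin n → V →ₗ[K] V') (D : V →ₗ[K] V') (s : PolyAlg n K) (v : V) :
    koszulD Y D (s ⊗ₜ[K] v) =
      ∑ l : Fin n, (MvPolynomial.X l * s) ⊗ₜ[K] Y l v + s ⊗ₜ[K] D v := by
  rw [koszulD, LinearMap.add_apply, LinearMap.sum_apply]
  rfl

theorem koszulD_koszulD (Y : Fin n → V →ₗ[K] V') (D : V →ₗ[K] V') (Y' : Fin n → V' →ₗ[K] V'')
    (D' : V' →ₗ[K] V'') (h1 : ∀ l v, Y' l (Y l v) = 0)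
    (h2 : ∀ k l v, Y' k (Y l v) + Y' l (Y k v) = 0)
    (h3 : ∀ l v, D' (Y l v) + Y' l (D v) = 0) (h4 : ∀ v, D' (D v) = 0) :
    koszulD Y' D' ∘ₗ koszulD Y D = 0 := by
  ext v
  have hs : ∑ l : Fin n, ∑ k : Fin n,
      ((MvPolynomial.X k * MvPolynomial.X l : PolyAlg n K) ⊗ₜ[K] Y' k (Y l v)) = 0 := by
    rw [← Finset.sum_product']
    refine Finset.sum_involution (fun p _ => (p.2, p.1)) ?_ ?_ ?_ ?_
    · intro p _
      rw [mul_comm (MvPolynomial.X p.2), ← TensorProduct.tmul_add, h2, TensorProduct.tmul_zero]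
    · intro p _ hp heq
      apply hp
      have h12 : p.2 = p.1 := congrArg Prod.fst heq
      rw [h12, h1, TensorProduct.tmul_zero]
    · intro p _
      exact Finset.mem_univ _
    · intro p _
      rfl
  simp only [TensorProduct.AlgebraTensorModule.curry_apply,
    TensorProduct.curry_apply, LinearMap.restrictScalars_comp, LinearMap.comp_apply,
    LinearMap.coe_restrictScalars, koszulD_tmul, map_add, map_sum, mul_one, h4,
    TensorProduct.tmul_zero, add_zero, LinearMap.zero_apply]
  rw [Finset.sum_add_distrib, hs, zero_add, ← Finset.sum_add_distrib]
  refine Finset.sum_eq_zero fun l _ => ?_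
  rw [← TensorProduct.tmul_add, h3, TensorProduct.tmul_zero]

theorem koszulD_comm (Y : Fin n → V →ₗ[K] V') (D : V →ₗ[K] V') (Z : Fin n → W →ₗ[K] W')
    (F : W →ₗ[K] W') (g : V →ₗ[K] W) (g' : V' →ₗ[K] W') (h1 : ∀ l, g' ∘ₗ Y l = Z l ∘ₗ g)
    (h2 : g' ∘ₗ D = F ∘ₗ g) :
    koszulD Z F ∘ₗ g.baseChange (PolyAlg n K) = g'.baseChange (PolyAlg n K) ∘ₗ koszulD Y D := by
  ext v
  simp only [TensorProduct.AlgebraTensorModule.curry_apply,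
    TensorProduct.curry_apply, LinearMap.restrictScalars_comp, LinearMap.comp_apply,
    LinearMap.coe_restrictScalars, koszulD_tmul, map_add, map_sum, LinearMap.baseChange_tmul]
  congr 1
  · refine Finset.sum_congr rfl fun l _ => ?_
    congr 1
    exact (LinearMap.congr_fun (h1 l) v).symm
  · congr 1
    exact (LinearMap.congr_fun h2 v).symm

end Koszul

/-- `N^i_{i-m}`, the summands of `⨁_{i-j=m} N^i_j`. -/
abbrev bggV (N : CochainComplex (GrMod (extGr n K)) ℤ) (m i : ℤ) : Type u := (N.X i).gr (i - m)

/-- `L(N)^m = S ⊗ ⨁_{i-j=m} N^i_j`, graded so that `s ⊗ z` has degree `deg s + deg z`. -/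
def bggTerm (N : CochainComplex (GrMod (extGr n K)) ℤ) (m : ℤ) : GrMod (symGr n K) :=
  freeMod (bggV N m) (fun i => i - m) n

/-- Multiplication by `y_l` from `⨁_{i-j=m} N^i_j` to `⨁_{i-j=m+1} N^i_j`. -/
def bggY (N : CochainComplex (GrMod (extGr n K)) ℤ) (m m' : ℤ) (h : m + 1 = m') (l : Fin n) :
    (⨁ i, bggV N m i) →ₗ[K] (⨁ i, bggV N m' i) :=
  DirectSum.toModule K ℤ _ fun i =>
    DirectSum.lof K ℤ (bggV N m') i ∘ₗ yAct (N.X i) l (i - m) (i - m') (by lia)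

/-- The map `z ↦ (-1)^m δ z` from `⨁_{i-j=m} N^i_j` to `⨁_{i-j=m+1} N^i_j`, where `δ` is the
differential of `N`. -/
def bggδ (N : CochainComplex (GrMod (extGr n K)) ℤ) (m m' : ℤ) (h : m + 1 = m') :
    (⨁ i, bggV N m i) →ₗ[K] (⨁ i, bggV N m' i) :=
  DirectSum.toModule K ℤ _ fun i =>
    DirectSum.lof K ℤ (bggV N m') (i + 1) ∘ₗ
      (m.negOnePow • grMap (N.d i (i + 1)) (i - m) (i + 1 - m') (by lia))

/-- The differential of `L(N)`:
`s ⊗ z ↦ ∑_l x_l s ⊗ y_l z + (-1)^m s ⊗ δ z` for `z ∈ N^i_j`, `i - j = m`. -/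
def bggD (N : CochainComplex (GrMod (extGr n K)) ℤ) (m m' : ℤ) (h : m + 1 = m') :
    PolyAlg n K ⊗[K] (⨁ i, bggV N m i) →ₗ[PolyAlg n K] PolyAlg n K ⊗[K] (⨁ i, bggV N m' i) :=
  koszulD (bggY N m m' h) (bggδ N m m' h)

theorem bggY_lof (N : CochainComplex (GrMod (extGr n K)) ℤ) (m m' : ℤ) (h : m + 1 = m')
    (l : Fin n) (i : ℤ) (z : bggV N m i) :
    bggY N m m' h l (DirectSum.lof K ℤ (bggV N m) i z) =
      DirectSum.lof K ℤ (bggV N m') i (yAct (N.X i) l (i - m) (i - m') (by lia) z) := by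
  rw [bggY, DirectSum.toModule_lof]
  rfl

theorem bggδ_lof (N : CochainComplex (GrMod (extGr n K)) ℤ) (m m' : ℤ) (h : m + 1 = m')
    (i : ℤ) (z : bggV N m i) :
    bggδ N m m' h (DirectSum.lof K ℤ (bggV N m) i z) =
      DirectSum.lof K ℤ (bggV N m') (i + 1)
        (m.negOnePow • grMap (N.d i (i + 1)) (i - m) (i + 1 - m') (by lia) z) := by
  rw [bggδ, DirectSum.toModule_lof]
  rfl

theorem bggD_mem (N : CochainComplex (GrMod (extGr n K)) ℤ) (m m' : ℤ) (h : m + 1 = m') (d : ℤ)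
    (t : PolyAlg n K ⊗[K] (⨁ i, bggV N m i))
    (ht : t ∈ freePiece (bggV N m) (fun i => i - m) d) :
    bggD N m m' h t ∈ freePiece (bggV N m') (fun i => i - m') d := by
  refine freeMod_map_mem (bggV N m) (fun i => i - m) (bggTerm N m') (bggD N m m' h) ?_ d t ht
  intro i v
  change bggD N m m' h (1 ⊗ₜ[K] DirectSum.lof K ℤ (bggV N m) i v) ∈
    freePiece (bggV N m') (fun i => i - m') (i - m)
  rw [bggD, koszulD_tmul, bggδ_lof]
  refine Submodule.add_mem _ (Submodule.sum_mem _ fun l _ => ?_) ?_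
  · rw [bggY_lof]
    refine tmul_mem_freePiece (bggV N m') (fun i => i - m') ?_ _
    rw [mul_one, show i - m - (i - m') = 1 by lia]
    exact MvPolynomial.isWeightedHomogeneous_X K (fun _ : Fin n => (1 : ℤ)) l
  · refine tmul_mem_freePiece (bggV N m') (fun i => i - m') ?_ _
    rw [show i - m - (i + 1 - m') = 0 by lia]
    exact MvPolynomial.isWeightedHomogeneous_one K (fun _ : Fin n => (1 : ℤ))

theorem map_sign_smul {F X Y : Type*} [AddCommGroup X] [AddCommGroup Y] [FunLike F X Y]
    [AddMonoidHomClass F X Y] (f : F) (u : ℤˣ) (x : X) : f (u • x) = u • f x := by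
  rcases Int.units_eq_one_or u with rfl | rfl
  · rw [one_smul, one_smul]
  · rw [Units.neg_smul, one_smul, Units.neg_smul, one_smul, map_neg]

theorem bggY_bggY_self (N : CochainComplex (GrMod (extGr n K)) ℤ) (m m' m'' : ℤ) (h : m + 1 = m')
    (h' : m' + 1 = m'') (l : Fin n) (z : ⨁ i, bggV N m i) :
    bggY N m' m'' h' l (bggY N m m' h l z) = 0 := by
  induction z using DirectSum.induction_on with
  | zero => rw [map_zero, map_zero]
  | add x y hx hy => rw [map_add, map_add, hx, hy, add_zero]
  | of i v =>
    rw [← DirectSum.lof_eq_of K, bggY_lof, bggY_lof]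
    have h0 : yAct (N.X i) l (i - m') (i - m'') (by lia)
        (yAct (N.X i) l (i - m) (i - m') (by lia) v) = 0 := by
      refine Subtype.ext ?_
      change extY n K l • extY n K l • v.1 = 0
      rw [← mul_smul, extY_mul_self, zero_smul]
    rw [h0, map_zero]

theorem bggY_bggY_comm (N : CochainComplex (GrMod (extGr n K)) ℤ) (m m' m'' : ℤ) (h : m + 1 = m')
    (h' : m' + 1 = m'') (k l : Fin n) (z : ⨁ i, bggV N m i) :
    bggY N m' m'' h' k (bggY N m m' h l z) = -bggY N m' m'' h' l (bggY N m m' h k z) := by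
  induction z using DirectSum.induction_on with
  | zero => rw [map_zero, map_zero, map_zero, map_zero, neg_zero]
  | add x y hx hy => rw [map_add, map_add, map_add, map_add, hx, hy, neg_add]
  | of i v =>
    rw [← DirectSum.lof_eq_of K, bggY_lof, bggY_lof, bggY_lof, bggY_lof, ← map_neg]
    congr 1
    refine Subtype.ext ?_
    change extY n K k • extY n K l • v.1 = -(extY n K l • extY n K k • v.1)
    rw [← mul_smul, extY_mul_comm, neg_smul, mul_smul]

theorem bggδ_bggY (N : CochainComplex (GrMod (extGr n K)) ℤ) (m m' m'' : ℤ) (h : m + 1 = m')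
    (h' : m' + 1 = m'') (l : Fin n) (z : ⨁ i, bggV N m i) :
    bggδ N m' m'' h' (bggY N m m' h l z) = -bggY N m' m'' h' l (bggδ N m m' h z) := by
  induction z using DirectSum.induction_on with
  | zero => rw [map_zero, map_zero, map_zero, map_zero, neg_zero]
  | add x y hx hy => rw [map_add, map_add, map_add, map_add, hx, hy, neg_add]
  | of i v =>
    rw [← DirectSum.lof_eq_of K, bggY_lof, bggδ_lof, bggδ_lof, bggY_lof, ← map_neg]
    congr 1
    refine Subtype.ext ?_
    change m'.negOnePow • toLin (N.d i (i + 1)) (extY n K l • v.1) =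
      -(extY n K l • m.negOnePow • toLin (N.d i (i + 1)) v.1)
    rw [map_smul, ← h, Int.negOnePow_succ, Units.neg_smul, smul_comm]

theorem bggδ_bggδ (N : CochainComplex (GrMod (extGr n K)) ℤ) (m m' m'' : ℤ) (h : m + 1 = m')
    (h' : m' + 1 = m'') (z : ⨁ i, bggV N m i) :
    bggδ N m' m'' h' (bggδ N m m' h z) = 0 := by
  induction z using DirectSum.induction_on with
  | zero => rw [map_zero, map_zero]
  | add x y hx hy => rw [map_add, map_add, hx, hy, add_zero]
  | of i v =>
    rw [← DirectSum.lof_eq_of K, bggδ_lof, bggδ_lof]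
    have h0 : grMap (N.d (i + 1) (i + 1 + 1)) (i + 1 - m') (i + 1 + 1 - m'') (by lia)
        (m.negOnePow • grMap (N.d i (i + 1)) (i - m) (i + 1 - m') (by lia) v) = 0 := by
      rw [map_sign_smul]
      have h1 : grMap (N.d (i + 1) (i + 1 + 1)) (i + 1 - m') (i + 1 + 1 - m'') (by lia)
          (grMap (N.d i (i + 1)) (i - m) (i + 1 - m') (by lia) v) = 0 := by
        refine Subtype.ext ?_
        change (toLin (N.d (i + 1) (i + 1 + 1)) ∘ₗ toLin (N.d i (i + 1))) v.1 = 0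
        rw [← toLin_comp, N.d_comp_d, toLin_zero, LinearMap.zero_apply]
      rw [h1, smul_zero]
    rw [h0, smul_zero, map_zero]

theorem bggD_bggD (N : CochainComplex (GrMod (extGr n K)) ℤ) (m m' m'' : ℤ) (h : m + 1 = m')
    (h' : m' + 1 = m'') : bggD N m' m'' h' ∘ₗ bggD N m m' h = 0 :=
  koszulD_koszulD _ _ _ _ (bggY_bggY_self N m m' m'' h h')
    (fun k l z => by rw [bggY_bggY_comm, neg_add_cancel])
    (fun l z => by rw [bggδ_bggY, neg_add_cancel])
    (bggδ_bggδ N m m' m'' h h')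

/-- The complex `L(N)` of graded free `S`-modules. -/
def bggObj (N : CochainComplex (GrMod (extGr n K)) ℤ) : CochainComplex (GrMod (symGr n K)) ℤ where
  X m := bggTerm N m
  d m m' := if h : m + 1 = m' then
    ofLin (M := bggTerm N m) (N := bggTerm N m') (bggD N m m' h) (bggD_mem N m m' h) else 0
  shape _ _ h := dif_neg h
  d_comp_d' m m' m'' h h' := by
    rw [dif_pos (show m + 1 = m' from h), dif_pos (show m' + 1 = m'' from h')]
    exact hom_ext (bggD_bggD N m m' m'' h h')

theorem bggObj_d (N : CochainComplex (GrMod (extGr n K)) ℤ) (m m' : ℤ) (h : m + 1 = m') :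
    (bggObj N).d m m' =
      ofLin (M := bggTerm N m) (N := bggTerm N m') (bggD N m m' h) (bggD_mem N m m' h) :=
  dif_pos h

/-- The map `⨁_{i-j=m} M^i_j → ⨁_{i-j=m} N^i_j` induced by a morphism `M → N`. -/
def bggMapV {M N : CochainComplex (GrMod (extGr n K)) ℤ} (g : M ⟶ N) (m : ℤ) :
    (⨁ i, bggV M m i) →ₗ[K] (⨁ i, bggV N m i) :=
  DirectSum.lmap fun i => grMap (g.f i) (i - m) (i - m) rfl

theorem bggMapV_lof {M N : CochainComplex (GrMod (extGr n K)) ℤ} (g : M ⟶ N) (m i : ℤ)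
    (z : bggV M m i) : bggMapV g m (DirectSum.lof K ℤ (bggV M m) i z) =
      DirectSum.lof K ℤ (bggV N m) i (grMap (g.f i) (i - m) (i - m) rfl z) := by
  rw [bggMapV, DirectSum.lmap_lof]

theorem bggMapV_bggY {M N : CochainComplex (GrMod (extGr n K)) ℤ} (g : M ⟶ N) (m m' : ℤ)
    (h : m + 1 = m') (l : Fin n) (i : ℤ) (z : bggV M m i) :
    bggMapV g m' (bggY M m m' h l (DirectSum.lof K ℤ (bggV M m) i z)) =
      bggY N m m' h l (bggMapV g m (DirectSum.lof K ℤ (bggV M m) i z)) := by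
  rw [bggY_lof, bggMapV_lof, bggMapV_lof, bggY_lof]
  congr 1
  refine Subtype.ext ?_
  exact map_smul (toLin (g.f i)) (extY n K l) z.1

theorem bggMapV_bggδ {M N : CochainComplex (GrMod (extGr n K)) ℤ} (g : M ⟶ N) (m m' : ℤ)
    (h : m + 1 = m') (i : ℤ) (z : bggV M m i) :
    bggMapV g m' (bggδ M m m' h (DirectSum.lof K ℤ (bggV M m) i z)) =
      bggδ N m m' h (bggMapV g m (DirectSum.lof K ℤ (bggV M m) i z)) := by
  rw [bggδ_lof, bggMapV_lof, bggMapV_lof, bggδ_lof, map_sign_smul]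
  congr 2
  refine Subtype.ext ?_
  change (toLin (g.f (i + 1)) ∘ₗ toLin (M.d i (i + 1))) z.1 =
    (toLin (N.d i (i + 1)) ∘ₗ toLin (g.f i)) z.1
  rw [← toLin_comp, ← toLin_comp, g.comm]

theorem bggMap_mem {M N : CochainComplex (GrMod (extGr n K)) ℤ} (g : M ⟶ N) (m d : ℤ)
    (t : PolyAlg n K ⊗[K] (⨁ i, bggV M m i))
    (ht : t ∈ freePiece (bggV M m) (fun i => i - m) d) :
    (bggMapV g m).baseChange (PolyAlg n K) t ∈ freePiece (bggV N m) (fun i => i - m) d := by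
  refine freeMod_map_mem (bggV M m) (fun i => i - m) (bggTerm N m)
    ((bggMapV g m).baseChange (PolyAlg n K)) ?_ d t ht
  intro i v
  change (1 : PolyAlg n K) ⊗ₜ[K] bggMapV g m (DirectSum.lof K ℤ (bggV M m) i v) ∈
    freePiece (bggV N m) (fun i => i - m) (i - m)
  rw [bggMapV_lof]
  refine tmul_mem_freePiece (bggV N m) (fun i => i - m) ?_ _
  rw [sub_self]
  exact MvPolynomial.isWeightedHomogeneous_one K (fun _ : Fin n => (1 : ℤ))

theorem bggMap_comm {M N : CochainComplex (GrMod (extGr n K)) ℤ} (g : M ⟶ N) (m m' : ℤ)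
    (h : m + 1 = m') : bggD N m m' h ∘ₗ (bggMapV g m).baseChange (PolyAlg n K) =
      (bggMapV g m').baseChange (PolyAlg n K) ∘ₗ bggD M m m' h :=
  koszulD_comm _ _ _ _ _ _
    (fun l => DirectSum.linearMap_ext K fun i =>
      LinearMap.ext fun v => bggMapV_bggY g m m' h l i v)
    (DirectSum.linearMap_ext K fun i => LinearMap.ext fun v => bggMapV_bggδ g m m' h i v)

/-- The chain map `L(M) → L(N)`, `s ⊗ z ↦ s ⊗ g z`, induced by a chain map `g : M → N`. -/
def bggMap {M N : CochainComplex (GrMod (extGr n K)) ℤ} (g : M ⟶ N) : bggObj M ⟶ bggObj N where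
  f m := ofLin (M := bggTerm M m) (N := bggTerm N m)
    ((bggMapV g m).baseChange (PolyAlg n K)) (bggMap_mem g m)
  comm' m m' h := by
    rw [bggObj_d M m m' h, bggObj_d N m m' h]
    exact hom_ext (bggMap_comm g m m' h)

/-- The functor `L` on complexes. -/
def bggL (n : ℕ) (K : Type u) [Field K] :
    CochainComplex (GrMod (extGr n K)) ℤ ⥤ CochainComplex (GrMod (symGr n K)) ℤ where
  obj := bggObj
  map := bggMap
  map_id N := by
    ext m : 1
    refine hom_ext ?_
    refine freeMod_lin_ext _ fun i v => ?_
    change (1 : PolyAlg n K) ⊗ₜ[K] bggMapV (𝟙 N) m (DirectSum.lof K ℤ (bggV N m) i v) =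
      1 ⊗ₜ[K] DirectSum.lof K ℤ (bggV N m) i v
    rw [bggMapV_lof]
    rfl
  map_comp {M N P} g g' := by
    ext m : 1
    refine hom_ext ?_
    refine freeMod_lin_ext _ fun i v => ?_
    change (1 : PolyAlg n K) ⊗ₜ[K] bggMapV (g ≫ g') m (DirectSum.lof K ℤ (bggV M m) i v) =
      1 ⊗ₜ[K] bggMapV g' m (bggMapV g m (DirectSum.lof K ℤ (bggV M m) i v))
    rw [bggMapV_lof, bggMapV_lof, bggMapV_lof]
    rfl

end BGG

/-- The functor `D_S = Hom•_S(-, ω)` on complexes. -/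
def symDual {n : ℕ} {K : Type u} [Field K] (ω : CochainComplex (GrMod (symGr n K)) ℤ) :
    (CochainComplex (GrMod (symGr n K)) ℤ)ᵒᵖ ⥤ CochainComplex (GrMod (symGr n K)) ℤ :=
  GrMod.homFunctor (symGr_iSup n K) ω

/-- The functor `M ↦ M(j)[k]` on complexes. -/
def twistShift (n : ℕ) (K : Type u) [Field K] (j k : ℤ) :
    CochainComplex (GrMod (symGr n K)) ℤ ⥤ CochainComplex (GrMod (symGr n K)) ℤ :=
  (GrMod.twist (symGr n K) j).mapHomologicalComplex (ComplexShape.up ℤ) ⋙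
    shiftFunctor (CochainComplex (GrMod (symGr n K)) ℤ) k

end

/-! The exterior algebra is a Frobenius algebra. Let top be the coefficient of y_1⋯y_n; then (a, e)
↦ top(ae) is a perfect pairing on E (`extFrobenius`). Consequently f ↦ top ∘ f identifies the right
linear maps N → E of degree d with the K-dual of N_{-n-d} (`dualPiece_eq_zero`, `exists_dualPiece`):
up to regrading, D_E is vector space duality.

For N bounded with finitely generated terms, each term of L(N) is S ⊗ V with V finite-dimensional,
and Hom_S(S ⊗ V, S) = S ⊗ V^*. So Hom(L(N), S(-n)[n]) and L(D_E(N))(-2n)[2n] have the same terms.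
The comparison sends s ⊗ f to the cochain s' ⊗ z ↦ ± s s' top(f z) u, where u generates S(-n)[n].
One n in the shift comes from top living in degree -n, the other from S(-n)[n]. With the sign
`pairSign` this is a chain map (`pairLin_comm`); it is natural in N (`pairLin_naturality`) and
bijective in each degree (`pairLin_bijective`), hence an isomorphism of complexes.

It remains to pass from S(-n)[n] to ω. The complex L(N) is bounded with free terms, hence
K-projective over S, so Hom(L(N), -) preserves quasi-isomorphisms. Quasi-isomorphisms are tested
after forgetting the grading, so this can be applied in the category of all S-modules, once it is
known that every cochain out of L(N) is a sum of homogeneous ones (`homTotal_bggObj`,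
`quasiIso_homComplexPost`).

The composite L(D_E(-))(-2n)[2n] → Hom(L(-), ω) is therefore a natural transformation whose
components at bounded finitely generated complexes are quasi-isomorphisms
(`quasiIso_dualityNatTrans`), and these become invertible in the derived category. -/

noncomputable section

/-! ### Quasi-isomorphisms on elements, and cochains out of K-projective complexes -/

section QuasiIso

/-- A chain map of complexes of modules which is injective and surjective on cohomology, tested on
elements, is a quasi-isomorphism. -/
theorem CochainComplex.quasiIso_of_elements {R : Type u} [Ring R]
    {A B : CochainComplex (ModuleCat.{u} R) ℤ} (φ : A ⟶ B)
    (hinj : ∀ (i j k : ℤ), i + 1 = j → j + 1 = k → ∀ (x : A.X j), (A.d j k).hom x = 0 →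
      ∀ y : B.X i, (φ.f j).hom x = (B.d i j).hom y → ∃ x' : A.X i, x = (A.d i j).hom x')
    (hsurj : ∀ (i j k : ℤ), i + 1 = j → j + 1 = k → ∀ (y : B.X j), (B.d j k).hom y = 0 →
      ∃ x : A.X j, (A.d j k).hom x = 0 ∧ ∃ y' : B.X i, y = (φ.f j).hom x + (B.d i j).hom y') :
    QuasiIso φ := by
  -- The Mathlib criteria work with arbitrary test objects up to epimorphic refinement. Refining to
  -- a free module allows lifts chosen elementwise to be prescribed on a basis and extended
  -- linearly.
  have mk (P : ModuleCat.{u} R) : ∃ (ι : Type u) (π : ModuleCat.of R (ι →₀ R) ⟶ P), Epi π :=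
    ⟨P, ModuleCat.ofHom (Finsupp.linearCombination R id), (ModuleCat.epi_iff_surjective _).2
      (Finsupp.linearCombination_surjective R Function.surjective_id)⟩
  refine ⟨fun j => ?_⟩
  rw [quasiIsoAt_iff_isIso_homologyMap]
  have hp : (ComplexShape.up ℤ).prev j = j - 1 := by simp
  have hn : (ComplexShape.up ℤ).next j = j + 1 := by simp
  have h1 : Mono (HomologicalComplex.homologyMap φ j) := by
    rw [HomologicalComplex.mono_homologyMap_iff_up_to_refinements φ (j - 1) j (j + 1) hp hn]
    intro P x hx y hxy
    obtain ⟨ι, π, hπ⟩ := mk P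
    have key (t : P) : ∃ x' : A.X (j - 1), x.hom t = (A.d (j - 1) j).hom x' :=
      hinj (j - 1) j (j + 1) (by lia) rfl (x.hom t) (ConcreteCategory.congr_hom hx t) (y.hom t)
        (ConcreteCategory.congr_hom hxy t)
    choose s hs using key
    refine ⟨_, π, hπ, ModuleCat.ofHom (Finsupp.linearCombination R
      fun i => s (π.hom (Finsupp.single i 1))), ?_⟩
    ext i
    simp [hs]
  have h2 : Epi (HomologicalComplex.homologyMap φ j) := by
    rw [HomologicalComplex.epi_homologyMap_iff_up_to_refinements φ (j - 1) j (j + 1) hp hn]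
    intro P y hy
    obtain ⟨ι, π, hπ⟩ := mk P
    have key (t : P) : ∃ x : A.X j, (A.d j (j + 1)).hom x = 0 ∧ ∃ y' : B.X (j - 1),
        y.hom t = (φ.f j).hom x + (B.d (j - 1) j).hom y' :=
      hsurj (j - 1) j (j + 1) (by lia) rfl (y.hom t) (ConcreteCategory.congr_hom hy t)
    choose s hs s' hs' using key
    refine ⟨_, π, hπ, ModuleCat.ofHom (Finsupp.linearCombination R
      fun i => s (π.hom (Finsupp.single i 1))), ?_, ModuleCat.ofHom (Finsupp.linearCombination R
      fun i => s' (π.hom (Finsupp.single i 1))), ?_⟩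
    · ext i
      simp [hs]
    · ext i
      simp [hs']
  exact isIso_of_mono_of_epi _

open HomotopyCategory in
attribute [local instance] HasDerivedCategory.standard in
/-- Postcomposition with a quasi-isomorphism is bijective on homotopy classes of maps out of a
K-projective complex. -/
theorem CochainComplex.IsKProjective.postcomp_bijective {C : Type*} [Category C] [Abelian C]
    (K : CochainComplex C ℤ) [K.IsKProjective] {A B : CochainComplex C ℤ} (η : A ⟶ B)
    [QuasiIso η] : Function.Bijective
      (fun g : (quotient C (.up ℤ)).obj K ⟶ (quotient C (.up ℤ)).obj A =>
        g ≫ (quotient C (.up ℤ)).map η) := by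
  -- For K-projective source, homotopy classes of maps coincide with morphisms in the derived
  -- category, where η becomes invertible.
  have h2 := Qh_map_bijective K ((quotient C (.up ℤ)).obj B)
  have hη : IsIso (DerivedCategory.Qh.map ((quotient C (.up ℤ)).map η)) :=
    (NatIso.isIso_map_iff (DerivedCategory.quotientCompQhIso C) η).2 inferInstance
  rw [← Function.Bijective.of_comp_iff' h2]
  have h3 : Function.Bijective (fun g : DerivedCategory.Qh.obj ((quotient C (.up ℤ)).obj K) ⟶
      DerivedCategory.Qh.obj ((quotient C (.up ℤ)).obj A) =>
        g ≫ DerivedCategory.Qh.map ((quotient C (.up ℤ)).map η)) :=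
    ((asIso (DerivedCategory.Qh.map ((quotient C (.up ℤ)).map η))).homToEquiv).bijective
  convert h3.comp (Qh_map_bijective K ((quotient C (.up ℤ)).obj A)) using 1
  ext g
  simp

/-- Degree m cohomology classes of the Hom complex are homotopy classes of maps to the m-th shift,
so this is bijectivity of postcomposition with the shifted η, split into its injective and
surjective halves. -/
theorem CochainComplex.IsKProjective.cohomologyClass_postcomp {C : Type*} [Category C] [Abelian C]
    (K : CochainComplex C ℤ) [K.IsKProjective] {A B : CochainComplex C ℤ} (η : A ⟶ B)
    [QuasiIso η] (m : ℤ) :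
    (∀ x : Cocycle K A m, CohomologyClass.mk (x.postcomp η) = 0 → CohomologyClass.mk x = 0) ∧
    ∀ y : Cocycle K B m, ∃ x : Cocycle K A m,
      CohomologyClass.mk (x.postcomp η) = CohomologyClass.mk y := by
  have hb := postcomp_bijective K (η⟦m⟧')
  have hn (x : Cocycle K A m) : CohomologyClass.toHom (CohomologyClass.mk (x.postcomp η)) =
      CohomologyClass.toHom (CohomologyClass.mk x) ≫
        (HomotopyCategory.quotient C (.up ℤ)).map (η⟦m⟧') := by
    rw [CohomologyClass.toHom_mk, CohomologyClass.toHom_mk, Cocycle.equivHomShift_symm_postcomp,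
      Functor.map_comp]
  constructor
  · intro x hx
    refine (CohomologyClass.toHom_bijective K A m).1 (hb.1 ?_)
    dsimp only
    rw [← hn, hx, map_zero, map_zero, Limits.zero_comp]
  · intro y
    obtain ⟨g, hg⟩ := hb.2 (CohomologyClass.toHom (CohomologyClass.mk y))
    obtain ⟨c, rfl⟩ := (CohomologyClass.toHom_bijective K A m).2 g
    obtain ⟨x, rfl⟩ := c.mk_surjective
    exact ⟨x, (CohomologyClass.toHom_bijective K B m).1 ((hn x).trans hg)⟩

/-- The injective half, with cocycles and coboundaries spelled out in the shape that
`CochainComplex.quasiIso_of_elements` asks for; `exists_cocycle` is the surjective half. -/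
theorem CochainComplex.IsKProjective.exists_coboundary {C : Type*} [Category C] [Abelian C]
    (K : CochainComplex C ℤ) [K.IsKProjective] {A B : CochainComplex C ℤ} (η : A ⟶ B)
    [QuasiIso η] {i j k : ℤ} (hij : i + 1 = j) (hjk : j + 1 = k) (x : Cochain K A j)
    (hx : δ j k x = 0) (y : Cochain K B i) (hxy : x.comp (Cochain.ofHom η) (add_zero j) = δ i j y) :
    ∃ w : Cochain K A i, x = δ i j w := by
  have h := (cohomologyClass_postcomp K η j).1 (Cocycle.mk x k hjk hx)
    ((CohomologyClass.mk_eq_zero_iff _).2 ⟨i, hij, y, hxy.symm⟩)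
  obtain ⟨w, hw⟩ := (mem_coboundaries_iff _ i hij).1 ((CohomologyClass.mk_eq_zero_iff _).1 h)
  exact ⟨w, hw.symm⟩

theorem CochainComplex.IsKProjective.exists_cocycle {C : Type*} [Category C] [Abelian C]
    (K : CochainComplex C ℤ) [K.IsKProjective] {A B : CochainComplex C ℤ} (η : A ⟶ B)
    [QuasiIso η] {i j k : ℤ} (hij : i + 1 = j) (hjk : j + 1 = k) (y : Cochain K B j)
    (hy : δ j k y = 0) : ∃ x : Cochain K A j, δ j k x = 0 ∧ ∃ w : Cochain K B i,
      y = x.comp (Cochain.ofHom η) (add_zero j) + δ i j w := by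
  obtain ⟨x, hx⟩ := (cohomologyClass_postcomp K η j).2 (Cocycle.mk y k hjk hy)
  have h : CohomologyClass.mk (Cocycle.mk y k hjk hy - x.postcomp η) = 0 := by
    rw [CohomologyClass.mk_sub, hx, sub_self]
  obtain ⟨w, hw⟩ := (mem_coboundaries_iff _ i hij).1 ((CohomologyClass.mk_eq_zero_iff _).1 h)
  refine ⟨x.1, x.δ_eq_zero k, w, ?_⟩
  rw [hw]
  exact (add_sub_cancel _ _).symm

end QuasiIso

namespace GrMod

/-! ### Postcomposition on the graded Hom complex -/

section Post

variable {K S : Type u} [Field K] [CommRing S] [Algebra K S] {𝒮 : ℤ → Submodule K S}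
  (h𝒮 : ⨆ i, 𝒮 i = ⊤)

theorem comp_ofHom_mem_homPiece (M : CochainComplex (GrMod 𝒮) ℤ)
    {I J : CochainComplex (GrMod 𝒮) ℤ} (g : I ⟶ J) (m d : ℤ)
    (f : Cochain (under M) (under I) m) (hf : f ∈ homPiece M I m d) :
    f.comp (Cochain.ofHom (underMap g)) (add_zero m) ∈ homPiece M J m d := by
  intro p q hpq i z hz
  have h : value (f.comp (Cochain.ofHom (underMap g)) (add_zero m)) p q hpq z =
      toLin (g.f q) (value f p q hpq z) := by
    change ((f.comp (Cochain.ofHom (underMap g)) (add_zero m)).v p q hpq).hom z = _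
    rw [Cochain.comp_zero_cochain_v, Cochain.ofHom_v]
    rfl
  rw [h]
  exact toLin_mem (g.f q) (hf p q hpq i z hz)

/-- Postcomposition with a chain map, on `Hom•(M, -)`. -/
def homComplexPost (M : CochainComplex (GrMod 𝒮) ℤ) {I J : CochainComplex (GrMod 𝒮) ℤ}
    (g : I ⟶ J) : homComplex h𝒮 M I ⟶ homComplex h𝒮 M J where
  f m := ofPiecesMap h𝒮 (homPiece_smul_mem M I m) (homPiece_iSupIndep M I m)
    (homPiece_smul_mem M J m) (homPiece_iSupIndep M J m)
    { toFun := fun f => f.comp (Cochain.ofHom (underMap g)) (add_zero m)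
      map_add' := fun _ _ => Cochain.add_comp _ _ _ _
      map_smul' := fun _ _ => Cochain.smul_comp _ _ _ _ }
    (comp_ofHom_mem_homPiece M g m)
  comm' m m' _ := by
    refine hom_ext (LinearMap.ext fun f => Subtype.ext ?_)
    exact δ_comp_ofHom f.1 (underMap g) m'

/-- Postcomposition with a chain map is natural in the first argument of `Hom•`. -/
def homFunctorPost {I J : CochainComplex (GrMod 𝒮) ℤ} (g : I ⟶ J) :
    homFunctor h𝒮 I ⟶ homFunctor h𝒮 J where
  app M := homComplexPost h𝒮 M.unop g
  naturality M N f := by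
    ext m : 1
    refine hom_ext (LinearMap.ext fun x => Subtype.ext ?_)
    exact Cochain.comp_assoc_of_first_is_zero_cochain (Cochain.ofHom (underMap f.unop))
      (Subtype.val x) (Cochain.ofHom (underMap g)) (add_zero m)

/-- All cochains from `M` to `I` are sums of homogeneous ones. -/
def HomTotal (M I : CochainComplex (GrMod 𝒮) ℤ) : Prop :=
  ∀ (m : ℤ) (f : Cochain (under M) (under I) m),
    f ∈ Submodule.span S (⋃ d, (homPiece M I m d : Set (Cochain (under M) (under I) m)))

/-- When all cochains are sums of homogeneous ones, the graded Hom complexes have the full ungraded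
Hom complexes underneath. The cochains produced by K-projectivity in the ungraded category then
automatically belong to the graded ones. -/
theorem quasiIso_homComplexPost (M : CochainComplex (GrMod 𝒮) ℤ)
    {I J : CochainComplex (GrMod 𝒮) ℤ} (g : I ⟶ J) (hg : quasiIso 𝒮 g)
    [(under M).IsKProjective] (hI : HomTotal M I) (hJ : HomTotal M J) :
    quasiIso 𝒮 (homComplexPost h𝒮 M g) := by
  have : QuasiIso (underMap g) := hg
  refine CochainComplex.quasiIso_of_elements _ ?_ ?_
  · intro i j k hij hjk x hx y hxy
    obtain ⟨w, hw⟩ := CochainComplex.IsKProjective.exists_coboundary (under M) (underMap g) hij hjk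
      (Subtype.val x) (congrArg Subtype.val hx) (Subtype.val y) (congrArg Subtype.val hxy)
    exact ⟨⟨w, hI i w⟩, Subtype.ext hw⟩
  · intro i j k hij hjk y hy
    obtain ⟨x, hx, w, hw⟩ := CochainComplex.IsKProjective.exists_cocycle (under M) (underMap g)
      hij hjk (Subtype.val y) (congrArg Subtype.val hy)
    exact ⟨⟨x, hI j x⟩, Subtype.ext hx, ⟨w, hJ i w⟩, Subtype.ext hw⟩

/-- An `S`-linear map as a morphism between terms of the underlying complexes. -/
def underHom {M I : CochainComplex (GrMod 𝒮) ℤ} {p q : ℤ}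
    (f : (M.X p).carrier →ₗ[S] (I.X q).carrier) : (under M).X p ⟶ (under I).X q :=
  ModuleCat.ofHom f

theorem single_mem_homPiece (M I : CochainComplex (GrMod 𝒮) ℤ) (m d : ℤ) (p q : ℤ)
    (hpq : p + m = q) (f : (M.X p).carrier →ₗ[S] (I.X q).carrier)
    (hf : ∀ i z, z ∈ (M.X p).gr i → f z ∈ (I.X q).gr (i + d)) :
    Cochain.single (underHom f) m ∈
      homPiece M I m d := by
  intro p' q' hpq' i z hz
  by_cases hp : p = p'
  · subst hp
    obtain rfl : q = q' := hpq.symm.trans hpq'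
    have : value (Cochain.single (underHom f) m) p q hpq' = f := by
      rw [value, Cochain.single_v]
      rfl
    rw [this]
    exact hf i z hz
  · have : value (Cochain.single (underHom f) m) p' q' hpq' = 0 := by
      rw [value, Cochain.single_v_eq_zero _ _ _ _ _ (fun h : p' = p => hp h.symm)]
      rfl
    rw [this]
    exact Submodule.zero_mem _

theorem isZero_under {M : CochainComplex (GrMod 𝒮) ℤ} {p : ℤ}
    (h : Limits.IsZero (M.X p)) : Limits.IsZero ((under M).X p) :=
  (forget 𝒮).map_isZero h

/-- For bounded `M`, it is enough to decompose the linear maps `M^p → I^q`. -/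
theorem homTotal_of_bounded (M I : CochainComplex (GrMod 𝒮) ℤ) (a b : ℤ)
    (hab : ∀ i, i < a ∨ b < i → Limits.IsZero (M.X i))
    (h : ∀ (p q : ℤ) (T : AddSubgroup ((M.X p).carrier →ₗ[S] (I.X q).carrier)),
      (∀ d f, (∀ i z, z ∈ (M.X p).gr i → f z ∈ (I.X q).gr (i + d)) → f ∈ T) → ∀ f, f ∈ T) :
    HomTotal M I := by
  intro m f
  have hs (p q : ℤ) (hpq : p + m = q) (g : (M.X p).carrier →ₗ[S] (I.X q).carrier) :
      Cochain.single (underHom g) m ∈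
      Submodule.span S (⋃ d, (homPiece M I m d : Set (Cochain (under M) (under I) m))) := by
    let F : ((M.X p).carrier →ₗ[S] (I.X q).carrier) →+ Cochain (under M) (under I) m :=
      { toFun := fun g => Cochain.single (underHom g) m
        map_zero' := Cochain.single_zero (K := under M) (L := under I) p q m
        map_add' := fun g g' => by
          refine Cochain.ext _ _ fun p' q' hpq' => ?_
          rw [Cochain.add_v]
          by_cases hp : p = p'
          · subst hp
            obtain rfl : q = q' := hpq.symm.trans hpq'
            rw [Cochain.single_v, Cochain.single_v, Cochain.single_v]
            rfl
          · have hp' : p' ≠ p := fun h => hp h.symm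
            rw [Cochain.single_v_eq_zero _ _ _ _ _ hp', Cochain.single_v_eq_zero _ _ _ _ _ hp',
              Cochain.single_v_eq_zero _ _ _ _ _ hp', add_zero] }
    refine h p q ((Submodule.span S _).toAddSubgroup.comap F) (fun d f hf => ?_) g
    exact Submodule.subset_span (Set.mem_iUnion.2 ⟨d, single_mem_homPiece M I m d p q hpq f hf⟩)
  -- Boundedness of M makes a cochain the finite sum of its components, so each component may be
  -- decomposed separately.
  have hf : f = ∑ p ∈ Finset.Icc a b, Cochain.single (f.v p (p + m) rfl) m := by
    refine Cochain.ext _ _ fun p q hpq => ?_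
    have hv : (∑ p ∈ Finset.Icc a b, Cochain.single (f.v p (p + m) rfl) m).v p q hpq =
        ∑ r ∈ Finset.Icc a b, (Cochain.single (f.v r (r + m) rfl) m).v p q hpq := by
      let ev : Cochain (under M) (under I) m →+ ((under M).X p ⟶ (under I).X q) :=
        { toFun := fun c => c.v p q hpq
          map_zero' := rfl
          map_add' := fun _ _ => rfl }
      exact map_sum ev (fun r => Cochain.single (f.v r (r + m) rfl) m) (Finset.Icc a b)
    rw [hv]
    by_cases hp : p ∈ Finset.Icc a b
    · rw [Finset.sum_eq_single_of_mem p hp fun r _ hr =>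
        Cochain.single_v_eq_zero _ _ _ _ _ (fun h => hr h.symm)]
      subst hpq
      rw [Cochain.single_v]
    · refine (isZero_under (hab p ?_)).eq_of_src _ _
      rw [Finset.mem_Icc] at hp
      lia
  rw [hf]
  exact Submodule.sum_mem _ fun p _ => hs p (p + m) rfl (f.v p (p + m) rfl).hom

end Post

/-! ### Homogeneous decomposition of maps out of free modules -/

section Free

variable {n : ℕ} {K : Type u} [Field K] (V : ℤ → Type u) [∀ i, AddCommGroup (V i)]
  [∀ i, Module K (V i)] (w : ℤ → ℤ)

/-- Linear maps out of a graded free module of finite rank are sums of homogeneous ones. -/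
theorem freeMod_mem_of_homogeneous (s : Finset ℤ) (hs : ∀ i ∉ s, Subsingleton (V i))
    [∀ i, Module.Finite K (V i)] (P : GrMod (symGr n K))
    (T : AddSubgroup (PolyAlg n K ⊗[K] (⨁ i, V i) →ₗ[PolyAlg n K] P.carrier))
    (hT : ∀ d (f : PolyAlg n K ⊗[K] (⨁ i, V i) →ₗ[PolyAlg n K] P.carrier),
      (∀ i z, z ∈ freePiece V w i → f z ∈ P.gr (i + d)) → f ∈ T)
    (f : PolyAlg n K ⊗[K] (⨁ i, V i) →ₗ[PolyAlg n K] P.carrier) : f ∈ T := by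
  classical
  -- The rank one map s ⊗ v ↦ s ξ(v_i) y. It is additive in y, and homogeneous of degree e - w i
  -- when y is homogeneous of degree e, so splitting y into homogeneous parts puts every such map
  -- into T.
  let E (i : ℤ) (ξ : V i →ₗ[K] K) : P.carrier →+
      ((PolyAlg n K ⊗[K] (⨁ i, V i)) →ₗ[PolyAlg n K] P.carrier) :=
    { toFun := fun y => LinearMap.liftBaseChange (PolyAlg n K)
        ((ξ ∘ₗ DirectSum.component K ℤ V i).smulRight y)
      map_zero' := by
        refine freeMod_lin_ext V fun j v => ?_
        simp
      map_add' := fun y y' => by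
        refine freeMod_lin_ext V fun j v => ?_
        simp }
  have hE (i : ℤ) (ξ : V i →ₗ[K] K) (y : P.carrier) : E i ξ y ∈ T := by
    have hy : y ∈ ⨆ e, P.gr e := by
      rw [P.internal.submodule_iSup_eq_top]
      trivial
    induction hy using Submodule.iSup_induction' with
    | zero => rw [map_zero]; exact T.zero_mem
    | add x y _ _ hx hy => rw [map_add]; exact T.add_mem hx hy
    | mem e y hy =>
      refine hT (e - w i) _ fun t z hz => ?_
      refine freeMod_map_mem V w (twistObj (e - w i) P) (E i ξ y) ?_ t z hz
      intro j v
      change E i ξ y (1 ⊗ₜ[K] DirectSum.lof K ℤ V j v) ∈ P.gr (w j + (e - w i))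
      have h1 : E i ξ y (1 ⊗ₜ[K] DirectSum.lof K ℤ V j v) =
          ξ (DirectSum.component K ℤ V i (DirectSum.lof K ℤ V j v)) • y := by
        simp [E]
      rw [h1]
      by_cases hij : j = i
      · subst hij
        rw [add_sub_cancel]
        exact Submodule.smul_mem _ _ hy
      · rw [DirectSum.component.of, dif_neg hij, map_zero, zero_smul]
        exact Submodule.zero_mem _
  -- Dual basis expansion: f is the finite sum of the rank one maps given by the coordinates of a
  -- basis and the values of f on that basis.
  have hf : f = ∑ i ∈ s, ∑ a, E i ((Module.finBasis K (V i)).coord a)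
      (f ((1 : PolyAlg n K) ⊗ₜ[K] DirectSum.lof K ℤ V i (Module.finBasis K (V i) a))) := by
    refine freeMod_lin_ext V fun j v => ?_
    have h1 : ∀ i, (∑ a, E i ((Module.finBasis K (V i)).coord a)
      (f ((1 : PolyAlg n K) ⊗ₜ[K] DirectSum.lof K ℤ V i (Module.finBasis K (V i) a))))
        ((1 : PolyAlg n K) ⊗ₜ[K] DirectSum.lof K ℤ V j v) =
        f ((1 : PolyAlg n K) ⊗ₜ[K] DirectSum.lof K ℤ V i
          (DirectSum.component K ℤ V i (DirectSum.lof K ℤ V j v))) := by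
      intro i
      conv_rhs => rw [← (Module.finBasis K (V i)).sum_repr
        (DirectSum.component K ℤ V i (DirectSum.lof K ℤ V j v))]
      rw [LinearMap.sum_apply, map_sum, TensorProduct.tmul_sum, map_sum]
      refine Finset.sum_congr rfl fun a _ => ?_
      rw [map_smul, TensorProduct.tmul_smul, ← algebraMap_smul (PolyAlg n K), map_smul,
        algebraMap_smul]
      simp [E]
    rw [LinearMap.sum_apply, Finset.sum_congr rfl fun i _ => h1 i]
    by_cases hj : j ∈ s
    · rw [Finset.sum_eq_single_of_mem j hj]
      · rw [DirectSum.component.lof_self]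
      · intro i _ hij
        rw [DirectSum.component.of, dif_neg hij.symm, map_zero, TensorProduct.tmul_zero, map_zero]
    · have := hs j hj
      rw [Subsingleton.elim v 0]
      simp
  rw [hf]
  exact T.sum_mem fun i _ => T.sum_mem fun a _ => hE _ _ _

end Free

end GrMod

/-! ### Linear maps out of internal direct sums -/

section InternalLift

variable {K M P : Type*} [Field K] [AddCommGroup M] [Module K M] [AddCommGroup P] [Module K P]
  {p : ℤ → Submodule K M}

/-- The linear map on an internal direct sum with prescribed restrictions to the summands. -/
def DirectSum.IsInternal.lift (h : DirectSum.IsInternal p) (f : ∀ i, p i →ₗ[K] P) : M →ₗ[K] P :=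
  DirectSum.toModule K ℤ P f ∘ₗ
    (LinearEquiv.ofBijective (DirectSum.coeLinearMap p) h).symm.toLinearMap

theorem DirectSum.IsInternal.lift_apply (h : DirectSum.IsInternal p) (f : ∀ i, p i →ₗ[K] P) (i : ℤ)
    (x : p i) : h.lift f x = f i x := by
  have h1 : (LinearEquiv.ofBijective (DirectSum.coeLinearMap p) h).symm (x : M) =
      DirectSum.lof K ℤ (fun i => p i) i x := by
    rw [LinearEquiv.symm_apply_eq]
    exact (DirectSum.coeLinearMap_lof p i x).symm
  rw [DirectSum.IsInternal.lift, LinearMap.comp_apply, LinearEquiv.coe_coe, h1,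
    DirectSum.toModule_lof]

theorem DirectSum.IsInternal.hom_ext (h : DirectSum.IsInternal p) {f g : M →ₗ[K] P}
    (hfg : ∀ i, ∀ x ∈ p i, f x = g x) : f = g := by
  have hle : ⨆ i, p i ≤ LinearMap.eqLocus f g := iSup_le fun i x hx => hfg i x hx
  rw [h.submodule_iSup_eq_top] at hle
  exact LinearMap.ext fun x => hle Submodule.mem_top

end InternalLift

/-! ### The exterior algebra as a graded Frobenius algebra, and duality over it -/

section Exterior

variable {n : ℕ} {K : Type u} [Field K]

variable (n K) in
/-- The basis of the exterior algebra consisting of the products of the `y_l`. -/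
def extBasis : Module.Basis (Finset (Fin n)) K (ExtAlg n K) :=
  (Pi.basisFun K (Fin n)).ExteriorAlgebra

instance : Module.Finite K (ExtAlg n K) := Module.Finite.of_basis (extBasis n K)

variable (n K) in
/-- The coefficient of `y_1 ⋯ y_n`. -/
def extTop : ExtAlg n K →ₗ[K] K := (extBasis n K).coord Finset.univ

theorem extTop_extBasis (s : Finset (Fin n)) :
    extTop n K (extBasis n K s) = if s = Finset.univ then 1 else 0 := by
  classical
  rw [extTop, Module.Basis.coord_apply, Module.Basis.repr_self, Finsupp.single_apply]

/-- The piece of degree -k is spanned by the products of k generators, and the full product y_1⋯y_n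
occurs among these only for k = n. -/
theorem extTop_of_mem {d : ℤ} (hd : d ≠ -n) {a : ExtAlg n K} (ha : a ∈ extGr n K d) :
    extTop n K a = 0 := by
  rcases extGr_eq n K d with ⟨k, rfl⟩ | h
  · rw [extGr_neg] at ha
    have h1 := ((Pi.basisFun K (Fin n)).exteriorPower k).sum_repr ⟨a, ha⟩
    have h2 := congrArg Subtype.val h1
    simp only [Submodule.coe_sum, Submodule.coe_smul] at h2
    rw [← h2, map_sum]
    refine Finset.sum_eq_zero fun s _ => ?_
    rw [map_smul, ← ExteriorAlgebra.basis_eq_coe_basis]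
    change _ • extTop n K (extBasis n K s.1) = 0
    rw [extTop_extBasis, if_neg, smul_zero]
    intro hs
    have h3 := s.2
    rw [Set.powersetCard.mem_iff, hs, Finset.card_univ, Fintype.card_fin] at h3
    exact hd (by rw [h3])
  · rw [h, Submodule.mem_bot] at ha
    rw [ha, map_zero]

/-- If s and t meet, the product of the basis vectors is zero; otherwise it is ± the basis vector of
s ∪ t, which is the full set only if s and t are complementary. -/
theorem extTop_extBasis_mul (s t : Finset (Fin n)) (hst : s ≠ tᶜ) :
    extTop n K (extBasis n K s * extBasis n K t) = 0 := by
  classical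
  by_cases h : Disjoint s t
  · have h1 := ExteriorAlgebra.basis_mul_of_disjoint (Pi.basisFun K (Fin n))
      (⟨s, rfl⟩ : Set.powersetCard (Fin n) s.card) (⟨t, rfl⟩ : Set.powersetCard (Fin n) t.card) h
    change extBasis n K s * extBasis n K t = _ • extBasis n K _ at h1
    rw [h1, map_sign_smul, extTop_extBasis, if_neg, smul_zero]
    intro h2
    rw [Set.powersetCard.coe_disjUnion] at h2
    refine hst (Finset.ext fun x => ?_)
    have h3 : x ∈ s ∪ t := by
      have := Finset.mem_univ x
      rwa [← h2, Finset.disjUnion_eq_union] at this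
    rw [Finset.mem_compl]
    exact ⟨fun hs => Finset.disjoint_left.1 h hs,
      fun ht => (Finset.mem_union.1 h3).resolve_right ht⟩
  · have h1 := ExteriorAlgebra.basis_mul_of_not_disjoint (Pi.basisFun K (Fin n))
      (⟨s, rfl⟩ : Set.powersetCard (Fin n) s.card) (⟨t, rfl⟩ : Set.powersetCard (Fin n) t.card) h
    change extBasis n K s * extBasis n K t = 0 at h1
    rw [h1, map_zero]

theorem extTop_extBasis_mul_compl (s : Finset (Fin n)) :
    extTop n K (extBasis n K s * extBasis n K sᶜ) ≠ 0 := by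
  classical
  have h1 := ExteriorAlgebra.basis_mul_of_disjoint (Pi.basisFun K (Fin n))
    (⟨s, rfl⟩ : Set.powersetCard (Fin n) s.card) (⟨sᶜ, rfl⟩ : Set.powersetCard (Fin n) sᶜ.card)
    disjoint_compl_right
  change extBasis n K s * extBasis n K sᶜ = _ • extBasis n K _ at h1
  rw [h1, map_sign_smul, extTop_extBasis, if_pos]
  · rcases Int.units_eq_one_or (Equiv.Perm.sign (Set.powersetCard.permOfDisjoint
      (s := (⟨s, rfl⟩ : Set.powersetCard (Fin n) s.card))
      (t := (⟨sᶜ, rfl⟩ : Set.powersetCard (Fin n) sᶜ.card)) disjoint_compl_right)) with h | h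
    · rw [h, one_smul]; exact one_ne_zero
    · rw [h, Units.neg_smul, one_smul]; exact neg_ne_zero.2 one_ne_zero
  · rw [Set.powersetCard.coe_disjUnion, Finset.disjUnion_eq_union]
    exact Finset.union_compl s

/-- Multiplying by the basis vector of the complement of t and taking top isolates the t-coordinate
of a, up to a nonzero scalar. -/
theorem extTop_mul_nondegenerate {a : ExtAlg n K} (h : ∀ e, extTop n K (a * e) = 0) : a = 0 := by
  refine (extBasis n K).ext_elem fun t => ?_
  have h1 := h (extBasis n K tᶜ)
  rw [← (extBasis n K).sum_repr a, Finset.sum_mul, map_sum,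
    Finset.sum_eq_single_of_mem t (Finset.mem_univ t), smul_mul_assoc, map_smul, smul_eq_mul,
    mul_eq_zero] at h1
  · rw [map_zero]
    exact h1.resolve_right (extTop_extBasis_mul_compl t)
  · intro s _ hs
    rw [smul_mul_assoc, map_smul, extTop_extBasis_mul _ _ (by rwa [compl_compl]), smul_zero]

variable (n K) in
/-- The exterior algebra is a Frobenius algebra: `a ↦ (e ↦ top (a e))` is an isomorphism. -/
def extFrobenius : ExtAlg n K ≃ₗ[K] Module.Dual K (ExtAlg n K) :=
  LinearMap.linearEquivOfInjective ((LinearMap.mul K (ExtAlg n K)).compr₂ (extTop n K))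
    ((injective_iff_map_eq_zero _).2 fun _ ha =>
      extTop_mul_nondegenerate fun e => LinearMap.congr_fun ha e)
    Subspace.dual_finrank_eq.symm

theorem extTop_extFrobenius_symm (φ : Module.Dual K (ExtAlg n K)) (e : ExtAlg n K) :
    extTop n K ((extFrobenius n K).symm φ * e) = φ e :=
  LinearMap.congr_fun ((extFrobenius n K).apply_symm_apply φ) e

theorem extTop_mul_ext {a b : ExtAlg n K}
    (h : ∀ i, ∀ e ∈ extGr n K i, extTop n K (a * e) = extTop n K (b * e)) : a = b :=
  (extFrobenius n K).injective ((extGr_isInternal n K).hom_ext h)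

/-- The pairing matches degree i only with degree -n-i. Hence the degree i component of the
representing element already represents φ, and nondegeneracy makes the other components vanish. -/
theorem extFrobenius_symm_mem (φ : Module.Dual K (ExtAlg n K)) (i : ℤ)
    (hφ : ∀ m, m + i ≠ -n → ∀ e ∈ extGr n K m, φ e = 0) :
    (extFrobenius n K).symm φ ∈ extGr n K i := by
  have h : (extFrobenius n K).symm φ ∈ ⨆ j, extGr n K j := extGr_iSup n K ▸ Submodule.mem_top
  rw [iSup_split_single _ i, Submodule.mem_sup] at h
  obtain ⟨x, hx, y, hy, hxy⟩ := h
  suffices (extFrobenius n K).symm φ = x by rwa [this]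
  refine extTop_mul_ext fun m e he => ?_
  by_cases hm : m + i = -n
  · rw [← hxy, add_mul, map_add, add_eq_left]
    have hle : (⨆ (j) (_ : j ≠ i), extGr n K j) ≤
        LinearMap.ker (extTop n K ∘ₗ LinearMap.mulRight K e) := by
      refine iSup₂_le fun j hj z hz => ?_
      refine extTop_of_mem (d := j + m) (fun h => hj ?_) (SetLike.mul_mem_graded hz he)
      lia
    exact hle hy
  · rw [extTop_extFrobenius_symm, hφ m hm e he,
      extTop_of_mem (d := i + m) (by lia) (SetLike.mul_mem_graded hx he)]

theorem negOnePow_smul_mul_assoc (i : ℤ) (a b : ExtAlg n K) :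
    (i.negOnePow • a) * b = i.negOnePow • (a * b) := map_sign_smul (LinearMap.mulRight K b) _ a

theorem mul_negOnePow_smul (i : ℤ) (a b : ExtAlg n K) :
    a * (i.negOnePow • b) = i.negOnePow • (a * b) := map_sign_smul (LinearMap.mulLeft K a) _ b

theorem ι_mul_of_mem_exteriorPower (v : Fin n → K) (k : ℕ) {b : ExtAlg n K}
    (hb : b ∈ ⋀[K]^k (Fin n → K)) :
    ExteriorAlgebra.ι K v * b = (k : ℤ).negOnePow • (b * ExteriorAlgebra.ι K v) := by
  induction hb using Submodule.pow_induction_on_left' with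
  | algebraMap r => simp [Algebra.commutes]
  | add x y i hx hy hx' hy' => rw [mul_add, hx', hy', add_mul, smul_add]
  | mem_mul m hm i x hx h =>
    obtain ⟨w, rfl⟩ := hm
    rw [← mul_assoc, eq_neg_of_add_eq_zero_left (ExteriorAlgebra.ι_add_mul_swap v w), neg_mul,
      mul_assoc, h, mul_negOnePow_smul, mul_assoc, Nat.cast_succ, Int.negOnePow_succ,
      Units.neg_smul]

theorem mul_of_mem_exteriorPower (j k : ℕ) {a b : ExtAlg n K} (ha : a ∈ ⋀[K]^j (Fin n → K))
    (hb : b ∈ ⋀[K]^k (Fin n → K)) : a * b = ((j : ℤ) * k).negOnePow • (b * a) := by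
  induction ha using Submodule.pow_induction_on_left' with
  | algebraMap r => simp [Algebra.commutes]
  | add x y i hx hy hx' hy' => rw [mul_add, add_mul, hx', hy', smul_add]
  | mem_mul m hm i x hx h =>
    obtain ⟨w, rfl⟩ := hm
    rw [mul_assoc, h, mul_negOnePow_smul, ← mul_assoc, ι_mul_of_mem_exteriorPower w k hb,
      negOnePow_smul_mul_assoc, mul_assoc, smul_smul, ← Int.negOnePow_add, Nat.cast_succ, add_mul,
      one_mul]

/-- The exterior algebra is graded commutative. -/
theorem extGr_mul_comm {i j : ℤ} {a b : ExtAlg n K} (ha : a ∈ extGr n K i) (hb : b ∈ extGr n K j) :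
    a * b = (i * j).negOnePow • (b * a) := by
  rcases extGr_eq n K i with ⟨k, rfl⟩ | hi
  · rcases extGr_eq n K j with ⟨m, rfl⟩ | hj
    · rw [extGr_neg] at ha hb
      rw [mul_of_mem_exteriorPower k m ha hb, neg_mul_neg]
    · rw [hj, Submodule.mem_bot] at hb
      rw [hb, mul_zero, zero_mul, smul_zero]
  · rw [hi, Submodule.mem_bot] at ha
    rw [ha, mul_zero, zero_mul, smul_zero]

/-- Moving y_l past f z, which has degree j + d, costs (-1)^{j+d}, and right linearity of f costs
(-1)^j. The remaining sign depends only on d, which makes a uniform comparison of the two Koszul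
differentials possible. -/
theorem extY_mul_apply (N : GrMod (extGr n K)) {d j : ℤ} {f : N.carrier →ₗ[K] ExtAlg n K}
    (hf : f ∈ dualPiece N d) {z : N.carrier} (hz : z ∈ N.gr j) (l : Fin n) :
    extY n K l * f z = d.negOnePow • f (extY n K l • z) := by
  rw [extGr_mul_comm (extY_mem n K l) (hf.2 j z hz), ← hf.1 (-1) j _ z (extY_mem n K l) hz,
    map_sign_smul, smul_smul, ← Int.negOnePow_add]
  congr 1
  rw [Int.negOnePow_eq_iff]
  exact ⟨-j - d, by ring⟩

variable (n K) in
/-- The linear map `e ↦ (-1)^{k deg e} e`. -/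
def extSign (k : ℤ) : ExtAlg n K →ₗ[K] ExtAlg n K :=
  (extGr_isInternal n K).lift fun i => (i * k).negOnePow • (extGr n K i).subtype

theorem extSign_apply (k : ℤ) {i : ℤ} {e : ExtAlg n K} (he : e ∈ extGr n K i) :
    extSign n K k e = (i * k).negOnePow • e :=
  (extGr_isInternal n K).lift_apply _ i ⟨e, he⟩

/-- A right linear map `N → E` of degree `d` is determined by its top coefficient on the part of
degree `-n-d`. -/
theorem dualPiece_eq_zero (N : GrMod (extGr n K)) {d j : ℤ} (hj : j + d = -n)
    {f : N.carrier →ₗ[K] ExtAlg n K} (hf : f ∈ dualPiece N d)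
    (h : ∀ z ∈ N.gr j, extTop n K (f z) = 0) : f = 0 := by
  refine N.internal.hom_ext fun k z hz => ?_
  refine extTop_mul_ext fun m e he => ?_
  rw [LinearMap.zero_apply, zero_mul, map_zero]
  -- By right linearity f z * e is ± f (e z). Either e z has degree j, where the hypothesis applies,
  -- or f z * e lies outside degree -n and its top coefficient vanishes for degree reasons.
  by_cases hm : m + k = j
  · rw [← hf.1 m k e z he hz, map_sign_smul, map_sign_smul, h _ (hm ▸ N.smul_mem m k e z he hz),
      smul_zero]
  · exact extTop_of_mem (d := k + d + m) (by lia) (SetLike.mul_mem_graded (hf.2 k z hz) he)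

/-- Every functional on the part of degree `-n-d` comes from a right linear map `N → E` of
degree `d`. -/
theorem exists_dualPiece (N : GrMod (extGr n K)) {d j : ℤ} (hj : j + d = -n)
    (φ : N.gr j →ₗ[K] K) : ∃ f ∈ dualPiece N d, ∀ z : N.gr j, extTop n K (f z) = φ z := by
  -- Extension of φ by zero to the other degrees; it is the functional that top ∘ f has to be.
  let ψ : N.carrier →ₗ[K] K := N.internal.lift (Pi.single j φ)
  have hψ0 {i : ℤ} (hi : i ≠ j) {z : N.carrier} (hz : z ∈ N.gr i) : ψ z = 0 := by
    have := N.internal.lift_apply (Pi.single j φ) i ⟨z, hz⟩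
    rwa [Pi.single_eq_of_ne hi] at this
  have hψ (z : N.gr j) : ψ z = φ z := by
    have := N.internal.lift_apply (Pi.single j φ) j z
    rwa [Pi.single_eq_same] at this
  -- Right linearity forces top(f(z) e) = (-1)^{deg e · deg z} ψ(e z). For fixed z the right side is
  -- a functional of e, and the Frobenius isomorphism turns it into the element f z.
  let L (k : ℤ) : N.gr k →ₗ[K] Module.Dual K (ExtAlg n K) :=
    LinearMap.mk₂ K (fun z e => ψ (extSign n K k e • z.1))
      (fun z z' e => by rw [Submodule.coe_add, smul_add, map_add])
      (fun c z e => by rw [Submodule.coe_smul, smul_comm, map_smul])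
      (fun z e e' => by rw [map_add, add_smul, map_add])
      (fun c z e => by rw [map_smul (extSign n K k), smul_assoc, map_smul])
  let f : N.carrier →ₗ[K] ExtAlg n K :=
    N.internal.lift fun k => (extFrobenius n K).symm.toLinearMap ∘ₗ L k
  have hf0 {k : ℤ} {z : N.carrier} (hz : z ∈ N.gr k) :
      f z = (extFrobenius n K).symm (L k ⟨z, hz⟩) := N.internal.lift_apply _ k ⟨z, hz⟩
  have hf {k i : ℤ} {z : N.carrier} (hz : z ∈ N.gr k) {e : ExtAlg n K} (he : e ∈ extGr n K i) :
      extTop n K (f z * e) = (i * k).negOnePow • ψ (e • z) := by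
    rw [hf0 hz, extTop_extFrobenius_symm]
    change ψ (extSign n K k e • z) = _
    rw [extSign_apply k he]
    rcases Int.even_or_odd (i * k) with h | h
    · rw [Int.negOnePow_even _ h, one_smul, one_smul]
    · rw [Int.negOnePow_odd _ h, Units.neg_smul, one_smul, Units.neg_smul, one_smul, neg_smul,
        map_neg]
  refine ⟨f, ⟨fun i k e z he hz => ?_, fun k z hz => ?_⟩, fun z => ?_⟩
  · refine extTop_mul_ext fun m e' he' => ?_
    rw [map_sign_smul, negOnePow_smul_mul_assoc, map_sign_smul,
      hf (N.smul_mem i k e z he hz) he', mul_assoc, hf hz (SetLike.mul_mem_graded he he'),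
      ← mul_smul e' e z, extGr_mul_comm he' he]
    have h1 : ((m * i).negOnePow • (e * e')) • z = (m * i).negOnePow • ((e * e') • z) := by
      rcases Int.even_or_odd (m * i) with h | h
      · rw [Int.negOnePow_even _ h, one_smul, one_smul]
      · rw [Int.negOnePow_odd _ h, Units.neg_smul, one_smul, Units.neg_smul, one_smul, neg_smul]
    rw [h1, map_sign_smul, smul_smul, smul_smul, ← Int.negOnePow_add, ← Int.negOnePow_add]
    congr 1
    rw [Int.negOnePow_eq_iff]
    exact ⟨m * i, by ring⟩
  · rw [hf0 hz]
    refine extFrobenius_symm_mem _ _ fun m hm e he => ?_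
    change ψ (extSign n K k e • z) = 0
    have h1 : extSign n K k e ∈ extGr n K m := by
      rw [extSign_apply k he]
      rcases Int.even_or_odd (m * k) with h | h
      · rwa [Int.negOnePow_even _ h, one_smul]
      · rw [Int.negOnePow_odd _ h, Units.neg_smul, one_smul]
        exact Submodule.neg_mem _ he
    exact hψ0 (by lia) (N.smul_mem m k _ z h1 hz)
  · have h1 := hf z.2 (SetLike.GradedOne.one_mem (A := extGr n K))
    rwa [mul_one, zero_mul, Int.negOnePow_zero, one_smul, one_smul, hψ] at h1

end Exterior

open GrMod

/-- An `S`-linear map that sends `1 ⊗ V_i` into degree `w i + e` is homogeneous of degree `e`. -/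
theorem freeMod_map_mem_add {n : ℕ} {K : Type u} [Field K] (V : ℤ → Type u)
    [∀ i, AddCommGroup (V i)] [∀ i, Module K (V i)] (w : ℤ → ℤ) (P : GrMod (symGr n K)) (e : ℤ)
    (φ : PolyAlg n K ⊗[K] (⨁ i, V i) →ₗ[PolyAlg n K] P.carrier)
    (h : ∀ i (v : V i), φ (1 ⊗ₜ[K] DirectSum.lof K ℤ V i v) ∈ P.gr (w i + e)) (d : ℤ)
    (t : PolyAlg n K ⊗[K] (⨁ i, V i)) (ht : t ∈ freePiece V w d) : φ t ∈ P.gr (d + e) :=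
  freeMod_map_mem V w (twistObj e P) φ h d t ht

/-! ### The pairing between the terms of D_E(N) and of N -/

section Pairing

variable {n : ℕ} {K : Type u} [Field K] (N : CochainComplex (GrMod (extGr n K)) ℤ)

/-- The map `N^{-i} → E` underlying an element of `D_E(N)^i`. -/
def dualVal (i : ℤ) :
    ((extDualObj N).X i).carrier →ₗ[K] ((N.X (-i)).carrier →ₗ[K] ExtAlg n K) where
  toFun f := f.1
  map_add' _ _ := rfl
  map_smul' _ _ := rfl

/-- The pairing `(f, z) ↦ top (f z)` of `D_E(N)^i_{i-M}` with `⨁_k N^k_{k-p}`. -/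
def bggPair (M p i : ℤ) :
    bggV (extDualObj N) M i →ₗ[K] (⨁ k, bggV N p k) →ₗ[K] K :=
  LinearMap.mk₂ K (fun f v => extTop n K
      (dualVal N i f.1 (DirectSum.component K ℤ (bggV N p) (-i) v).1))
    (fun f f' v => by rw [Submodule.coe_add, map_add, LinearMap.add_apply, map_add])
    (fun c f v => by rw [Submodule.coe_smul, map_smul, LinearMap.smul_apply, map_smul])
    (fun f v v' => by rw [map_add, Submodule.coe_add, map_add, map_add])
    (fun c f v => by rw [map_smul, Submodule.coe_smul, map_smul, map_smul])

theorem bggPair_lof {M p i k : ℤ} (h : k = -i) (f : bggV (extDualObj N) M i) (z : bggV N p k) :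
    bggPair N M p i f (DirectSum.lof K ℤ (bggV N p) k z) =
      extTop n K (dualVal N i f.1 (toLin (N.XIsoOfEq h).hom z.1)) := by
  subst h
  change extTop n K (dualVal N i f.1
    (DirectSum.component K ℤ (bggV N p) (-i) (DirectSum.lof K ℤ (bggV N p) (-i) z)).1) = _
  rw [DirectSum.component.lof_self, HomologicalComplex.XIsoOfEq_rfl]
  rfl

theorem bggPair_lof_of_ne {M p i k : ℤ} (h : k ≠ -i) (f : bggV (extDualObj N) M i)
    (z : bggV N p k) : bggPair N M p i f (DirectSum.lof K ℤ (bggV N p) k z) = 0 := by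
  change extTop n K (dualVal N i f.1
    (DirectSum.component K ℤ (bggV N p) (-i) (DirectSum.lof K ℤ (bggV N p) k z)).1) = _
  rw [DirectSum.component.of, dif_neg h, Submodule.coe_zero, map_zero, map_zero]

theorem dualVal_mem {M i : ℤ} (f : bggV (extDualObj N) M i) :
    dualVal N i f.1 ∈ dualPiece (N.X (-i)) (i - M) := f.2

/-- For k = -i the element f z has degree (k - p) + (i - M) = -p - M, and top sees only degree -n.
So the term of L(D_E(N)) in degree M pairs only with the term of L(N) in degree n - M. -/
theorem bggPair_eq_zero {M p i : ℤ} (h : p ≠ n - M) (f : bggV (extDualObj N) M i) :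
    bggPair N M p i f = 0 := by
  refine DirectSum.linearMap_ext K fun k => LinearMap.ext fun z => ?_
  change bggPair N M p i f (DirectSum.lof K ℤ (bggV N p) k z) = 0
  by_cases hk : k = -i
  · rw [bggPair_lof N hk]
    exact extTop_of_mem (d := k - p + (i - M)) (by lia)
      ((dualVal_mem N f).2 _ _ (toLin_mem (N.XIsoOfEq hk).hom z.2))
  · exact bggPair_lof_of_ne N hk f z

/-- Multiplication by y_l is self-adjoint up to sign, by `extY_mul_apply` for f of degree i - M. -/
theorem bggPair_yAct {M M' p p' i k : ℤ} (hM : M + 1 = M') (hp : p + 1 = p')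
    (l : Fin n) (f : bggV (extDualObj N) M i) (z : bggV N p k) :
    bggPair N M' p i (yAct ((extDualObj N).X i) l (i - M) (i - M') (by lia) f)
      (DirectSum.lof K ℤ (bggV N p) k z) =
    (i - M).negOnePow • bggPair N M p' i f
      (DirectSum.lof K ℤ (bggV N p') k (yAct (N.X k) l (k - p) (k - p') (by lia) z)) := by
  by_cases hk : k = -i
  · rw [bggPair_lof N hk, bggPair_lof N hk]
    change extTop n K (extY n K l * dualVal N i f.1 (toLin (N.XIsoOfEq hk).hom z.1)) =
      (i - M).negOnePow • extTop n K (dualVal N i f.1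
        (toLin (N.XIsoOfEq hk).hom (extY n K l • z.1)))
    rw [extY_mul_apply (N.X (-i)) (dualVal_mem N f) (toLin_mem (N.XIsoOfEq hk).hom z.2),
      map_sign_smul, map_smul (toLin (N.XIsoOfEq hk).hom)]
  · rw [bggPair_lof_of_ne N hk, bggPair_lof_of_ne N hk, smul_zero]

/-- The differential of D_E(N) is by definition (-1)^{i+1} times the transpose of that of N; the
remaining work is transport along k + 1 = -i. -/
theorem bggPair_d {M M' p p' i k : ℤ} (hM : M + 1 = M') (hp : p + 1 = p')
    (f : bggV (extDualObj N) M i) (z : bggV N p k) :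
    bggPair N M' p (i + 1) (grMap ((extDualObj N).d i (i + 1)) (i - M) (i + 1 - M') (by lia) f)
      (DirectSum.lof K ℤ (bggV N p) k z) =
    (i + 1).negOnePow • bggPair N M p' i f (DirectSum.lof K ℤ (bggV N p') (k + 1)
      (grMap (N.d k (k + 1)) (k - p) (k + 1 - p') (by lia) z)) := by
  by_cases hk : k = -(i + 1)
  · have hk' : k + 1 = -i := by lia
    rw [bggPair_lof N hk, bggPair_lof N hk']
    change extTop n K ((i + 1).negOnePow • dualVal N i f.1
      ((toLin (N.d (-(i + 1)) (-i)) ∘ₗ toLin (N.XIsoOfEq hk).hom) z.1)) =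
      (i + 1).negOnePow • extTop n K (dualVal N i f.1
        ((toLin (N.XIsoOfEq hk').hom ∘ₗ toLin (N.d k (k + 1))) z.1))
    rw [← toLin_comp, ← toLin_comp, HomologicalComplex.XIsoOfEq_hom_comp_d,
      HomologicalComplex.d_comp_XIsoOfEq_hom, map_sign_smul]
  · rw [bggPair_lof_of_ne N hk, bggPair_lof_of_ne N (by lia), smul_zero]

end Pairing

/-! ### The comparison map from L(D_E(N)) to the Hom complex of L(N) -/

section DualMap

variable {n : ℕ} {K : Type u} [Field K]

/-- A family of cycles of internal degree `n` in a complex of graded `S`-modules. -/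
structure CycleFamily (C : CochainComplex (GrMod (symGr n K)) ℤ) where
  elt : ∀ q, (C.X q).carrier
  mem : ∀ q, elt q ∈ (C.X q).gr n
  closed : ∀ q q', toLin (C.d q q') (elt q) = 0

variable {C : CochainComplex (GrMod (symGr n K)) ℤ} (u : CycleFamily C)
  (N : CochainComplex (GrMod (extGr n K)) ℤ)

/-- The cochain `s ⊗ z ↦ s top (f z) u` on `L(N)`. -/
def pairCochain (M m i : ℤ) (f : bggV (extDualObj N) M i) :
    Cochain (under (bggObj N)) (under C) m :=
  Cochain.mk fun p q _ => underHom (M := bggObj N) (I := C)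
    (LinearMap.liftBaseChange (PolyAlg n K) ((bggPair N M p i f).smulRight (u.elt q)))

theorem value_pairCochain (M m i : ℤ) (f : bggV (extDualObj N) M i) (p q : ℤ) (hpq : p + m = q) :
    value (pairCochain u N M m i f) p q hpq =
      LinearMap.liftBaseChange (PolyAlg n K) ((bggPair N M p i f).smulRight (u.elt q)) := rfl

theorem value_pairCochain_tmul (M m i : ℤ) (f : bggV (extDualObj N) M i) (p q : ℤ)
    (hpq : p + m = q) (s : PolyAlg n K) (v : ⨁ k, bggV N p k) :
    value (pairCochain u N M m i f) p q hpq (s ⊗ₜ[K] v) =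
      s • bggPair N M p i f v • u.elt q := by
  rw [value_pairCochain]
  exact LinearMap.liftBaseChange_tmul _ _ _ _

/-- The pairing is nonzero only for k = -i and p = n - M, and then (k - p) + (i - m) = M - m - n =
n, the degree of u. This is where the total shift 2n is needed. -/
theorem pairCochain_mem {M m : ℤ} (hM : M = m + 2 * n) (i : ℤ) (f : bggV (extDualObj N) M i) :
    pairCochain u N M m i f ∈ homPiece (bggObj N) C m (i - m) := by
  intro p q hpq t x hx
  refine freeMod_map_mem_add (bggV N p) (fun k => k - p) (C.X q) (i - m)
    (value (pairCochain u N M m i f) p q hpq) (fun k z => ?_) t x hx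
  change value (pairCochain u N M m i f) p q hpq
    (1 ⊗ₜ[K] DirectSum.lof K ℤ (bggV N p) k z) ∈ (C.X q).gr (k - p + (i - m))
  rw [value_pairCochain_tmul, one_smul]
  by_cases hk : k = -i
  · by_cases hp : p = n - M
    · have h : k - p + (i - m) = n := by lia
      rw [h]
      exact Submodule.smul_mem _ _ (u.mem q)
    · rw [bggPair_eq_zero N hp, LinearMap.zero_apply, zero_smul]
      exact Submodule.zero_mem _
  · rw [bggPair_lof_of_ne N hk, zero_smul]
    exact Submodule.zero_mem _

/-- The element of `Hom•(L(N), C)` given by an element of `D_E(N)^i_{i-M}`. -/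
def pairHom {M m : ℤ} (hM : M = m + 2 * n) (i : ℤ) : bggV (extDualObj N) M i →ₗ[K]
    (homTerm (symGr_iSup n K) (bggObj N) C m).carrier where
  toFun f := ⟨pairCochain u N M m i f,
    Submodule.subset_span (Set.mem_iUnion.2 ⟨i - m, pairCochain_mem u N hM i f⟩)⟩
  map_add' f f' := by
    refine Subtype.ext (Cochain.ext _ _ fun p q hpq => ModuleCat.hom_ext ?_)
    refine freeMod_lin_ext (bggV N p) fun k z => ?_
    change value (pairCochain u N M m i (f + f')) p q hpq (1 ⊗ₜ[K] DirectSum.lof K ℤ _ k z) =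
      value (pairCochain u N M m i f) p q hpq (1 ⊗ₜ[K] DirectSum.lof K ℤ _ k z) +
      value (pairCochain u N M m i f') p q hpq (1 ⊗ₜ[K] DirectSum.lof K ℤ _ k z)
    rw [value_pairCochain_tmul, value_pairCochain_tmul, value_pairCochain_tmul, map_add,
      LinearMap.add_apply, add_smul, smul_add]
  map_smul' c f := by
    refine Subtype.ext (Cochain.ext _ _ fun p q hpq => ModuleCat.hom_ext ?_)
    refine freeMod_lin_ext (bggV N p) fun k z => ?_
    change value (pairCochain u N M m i (c • f)) p q hpq (1 ⊗ₜ[K] DirectSum.lof K ℤ _ k z) =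
      algebraMap K (PolyAlg n K) c •
        value (pairCochain u N M m i f) p q hpq (1 ⊗ₜ[K] DirectSum.lof K ℤ _ k z)
    rw [value_pairCochain_tmul, value_pairCochain_tmul, map_smul, LinearMap.smul_apply,
      algebraMap_smul, one_smul, one_smul, smul_assoc]

/-- The sign `(-1)^{m(i+1) + (n+1)i}`. -/
def pairSign (n : ℕ) (m i : ℤ) : ℤˣ := (m * (i + 1) + (n + 1) * i).negOnePow

/-- The map `L(D_E(N))^M → Hom^m(L(N), C)`, `M = m + 2n`, on underlying modules. -/
def pairLin {M m : ℤ} (hM : M = m + 2 * n) : PolyAlg n K ⊗[K] (⨁ i, bggV (extDualObj N) M i)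
    →ₗ[PolyAlg n K] (homTerm (symGr_iSup n K) (bggObj N) C m).carrier :=
  LinearMap.liftBaseChange (PolyAlg n K)
    (DirectSum.toModule K ℤ _ fun i => pairSign n m i • pairHom u N hM i)

/-- The linear map `L(N)^p → I^q` given by a cochain. -/
def bggEval {I : CochainComplex (GrMod (symGr n K)) ℤ} {m : ℤ} (p q : ℤ) (hpq : p + m = q) :
    (homTerm (symGr_iSup n K) (bggObj N) I m).carrier →ₗ[PolyAlg n K]
      PolyAlg n K ⊗[K] (⨁ k, bggV N p k) →ₗ[PolyAlg n K] (I.X q).carrier where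
  toFun f := value (M := bggObj N) f.1 p q hpq
  map_add' _ _ := rfl
  map_smul' _ _ := rfl

variable {N} in
theorem bggEval_ext {I : CochainComplex (GrMod (symGr n K)) ℤ} {m : ℤ}
    {f g : (homTerm (symGr_iSup n K) (bggObj N) I m).carrier}
    (h : ∀ p q (hpq : p + m = q) k (z : bggV N p k),
      bggEval N p q hpq f (1 ⊗ₜ[K] DirectSum.lof K ℤ (bggV N p) k z) =
      bggEval N p q hpq g (1 ⊗ₜ[K] DirectSum.lof K ℤ (bggV N p) k z)) : f = g := by
  refine Subtype.ext (Cochain.ext _ _ fun p q hpq => ModuleCat.hom_ext ?_)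
  exact freeMod_lin_ext (bggV N p) fun k z => h p q hpq k z

theorem bggEval_pairHom {M m : ℤ} (hM : M = m + 2 * n) (i : ℤ)
    (f : bggV (extDualObj N) M i) (p q : ℤ) (hpq : p + m = q) (s : PolyAlg n K)
    (v : ⨁ k, bggV N p k) :
    bggEval N p q hpq (pairHom u N hM i f) (s ⊗ₜ[K] v) = s • bggPair N M p i f v • u.elt q :=
  value_pairCochain_tmul u N M m i f p q hpq s v

theorem pairLin_tmul {M m : ℤ} (hM : M = m + 2 * n) (s : PolyAlg n K) (i : ℤ)
    (f : bggV (extDualObj N) M i) : pairLin u N hM (s ⊗ₜ[K] DirectSum.lof K ℤ _ i f) =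
      s • pairSign n m i • pairHom u N hM i f := by
  rw [pairLin, LinearMap.liftBaseChange_tmul, DirectSum.toModule_lof]
  rfl

theorem bggEval_pairLin {M m : ℤ} (hM : M = m + 2 * n) (s : PolyAlg n K) (i : ℤ)
    (f : bggV (extDualObj N) M i) (p q : ℤ) (hpq : p + m = q) (s' : PolyAlg n K)
    (v : ⨁ k, bggV N p k) :
    bggEval N p q hpq (pairLin u N hM (s ⊗ₜ[K] DirectSum.lof K ℤ _ i f)) (s' ⊗ₜ[K] v) =
    pairSign n m i • bggPair N M p i f v • (s * s') • u.elt q := by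
  rw [pairLin_tmul, map_smul, LinearMap.smul_apply, map_sign_smul, LinearMap.smul_apply,
    bggEval_pairHom, smul_comm, smul_comm s' (bggPair N M p i f v), smul_comm s, mul_smul]

theorem pairLin_mem {M m : ℤ} (hM : M = m + 2 * n) (t : ℤ)
    (x : PolyAlg n K ⊗[K] (⨁ i, bggV (extDualObj N) M i))
    (hx : x ∈ freePiece (bggV (extDualObj N) M) (fun i => i - M) t) :
    pairLin u N hM x ∈ (homTerm (symGr_iSup n K) (bggObj N) C m).gr (t + 2 * n) := by
  refine freeMod_map_mem_add (bggV (extDualObj N) M) (fun i => i - M)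
    (homTerm (symGr_iSup n K) (bggObj N) C m) (2 * n) (pairLin u N hM)
    (fun i f => ?_) t x hx
  have h0 := pairLin_tmul u N hM 1 i f
  have h1 : pairHom u N hM i f ∈ (homTerm (symGr_iSup n K) (bggObj N) C m).gr
      (i - M + 2 * n) := by
    rw [show i - M + 2 * (n : ℤ) = i - m by lia]
    exact pairCochain_mem u N hM i f
  rw [one_smul] at h0
  rw [h0]
  rcases Int.units_eq_one_or (pairSign n m i) with hs | hs
  · rw [hs, one_smul]
    exact h1
  · rw [hs, Units.neg_smul, one_smul]
    exact Submodule.neg_mem _ h1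

/-- The map `L(D_E(N))(-2n)[2n]^m → Hom^m(L(N), C)`. -/
def pairMor {M m : ℤ} (hM : M = m + 2 * n) :
    twistObj (-(2 * (n : ℤ))) (bggTerm (extDualObj N) M) ⟶
      homTerm (symGr_iSup n K) (bggObj N) C m :=
  ofLin (M := twistObj (-(2 * (n : ℤ))) (bggTerm (extDualObj N) M))
    (N := homTerm (symGr_iSup n K) (bggObj N) C m) (pairLin u N hM) fun t x hx => by
    have h := pairLin_mem u N hM (t + -(2 * (n : ℤ))) x hx
    rwa [neg_add_cancel_right] at h

/-- The differential of `Hom•(L(N), I)`. -/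
def bggHomD (I : CochainComplex (GrMod (symGr n K)) ℤ) (m m' : ℤ) :
    (homTerm (symGr_iSup n K) (bggObj N) I m).carrier →ₗ[PolyAlg n K]
      (homTerm (symGr_iSup n K) (bggObj N) I m').carrier :=
  toLin ((homComplex (symGr_iSup n K) (bggObj N) I).d m m')

theorem bggEval_bggHomD {I : CochainComplex (GrMod (symGr n K)) ℤ} {m m' : ℤ} (hm : m + 1 = m')
    (f : (homTerm (symGr_iSup n K) (bggObj N) I m).carrier) (p p' q' q : ℤ) (hpq : p + m' = q)
    (hp : p + 1 = p') (hq : q' + 1 = q) (x : PolyAlg n K ⊗[K] (⨁ k, bggV N p k)) :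
    bggEval N p q hpq (bggHomD N I m m' f) x =
      toLin (I.d q' q) (bggEval N p q' (by lia) f x) +
        m'.negOnePow • bggEval N p' q (by lia) f (bggD N p p' hp x) := by
  change ((δ m m' f.1).v p q hpq).hom x = _
  rw [δ_v m m' hm f.1 p q hpq q' p' (by lia) hp]
  have h : bggD N p p' hp = toLin ((bggObj N).d p p') := by
    rw [bggObj_d N p p' hp]
    rfl
  rw [h]
  rfl

end DualMap

/-! ### Compatibility with the differentials -/

section DualMap

variable {n : ℕ} {K : Type u} [Field K]
variable {C : CochainComplex (GrMod (symGr n K)) ℤ} (u : CycleFamily C)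
  (N : CochainComplex (GrMod (extGr n K)) ℤ)

theorem bggPair_sign_left {M p i : ℤ} (e : ℤˣ) (f : bggV (extDualObj N) M i)
    (v : ⨁ k, bggV N p k) : bggPair N M p i (e • f) v = e • bggPair N M p i f v := by
  rcases Int.units_eq_one_or e with rfl | rfl
  · rw [one_smul, one_smul]
  · rw [Units.neg_smul, one_smul, Units.neg_smul, one_smul, map_neg, LinearMap.neg_apply]

theorem bggPair_sign_lof {M p i k : ℤ} (e : ℤˣ) (f : bggV (extDualObj N) M i)
    (z : bggV N p k) : bggPair N M p i f (DirectSum.lof K ℤ (bggV N p) k (e • z)) =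
      e • bggPair N M p i f (DirectSum.lof K ℤ (bggV N p) k z) := by
  rcases Int.units_eq_one_or e with rfl | rfl
  · rw [one_smul, one_smul]
  · rw [Units.neg_smul, one_smul, Units.neg_smul, one_smul, map_neg, map_neg]

theorem bggD_lof (m m' : ℤ) (h : m + 1 = m') (i : ℤ) (z : bggV N m i) :
    bggD N m m' h (1 ⊗ₜ[K] DirectSum.lof K ℤ (bggV N m) i z) =
      ∑ l, MvPolynomial.X l ⊗ₜ[K] DirectSum.lof K ℤ (bggV N m') i
        (yAct (N.X i) l (i - m) (i - m') (by lia) z) +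
      1 ⊗ₜ[K] DirectSum.lof K ℤ (bggV N m') (i + 1)
        (m.negOnePow • grMap (N.d i (i + 1)) (i - m) (i + 1 - m') (by lia) z) := by
  rw [bggD, koszulD_tmul, bggδ_lof]
  congr 1
  refine Finset.sum_congr rfl fun l _ => ?_
  rw [bggY_lof, mul_one]

theorem bggEval_pairLin_bggD {M m : ℤ} (hM : M = m + 2 * n) (i : ℤ) (f : bggV (extDualObj N) M i)
    (p p' q : ℤ) (hp : p + 1 = p') (hpq : p' + m = q) (k : ℤ) (z : bggV N p k) :
    bggEval N p' q hpq (pairLin u N hM (1 ⊗ₜ[K] DirectSum.lof K ℤ _ i f))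
      (bggD N p p' hp (1 ⊗ₜ[K] DirectSum.lof K ℤ _ k z)) =
    ∑ l, pairSign n m i • bggPair N M p' i f (DirectSum.lof K ℤ (bggV N p') k
        (yAct (N.X k) l (k - p) (k - p') (by lia) z)) •
          (1 * MvPolynomial.X l : PolyAlg n K) • u.elt q +
      pairSign n m i • (p.negOnePow • bggPair N M p' i f (DirectSum.lof K ℤ (bggV N p') (k + 1)
        (grMap (N.d k (k + 1)) (k - p) (k + 1 - p') (by lia) z))) •
          (1 * 1 : PolyAlg n K) • u.elt q := by
  rw [bggD_lof, map_add, map_sum, ← bggPair_sign_lof]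
  exact congrArg₂ (· + ·)
    (Finset.sum_congr rfl fun l _ => bggEval_pairLin u N hM 1 i f p' q hpq (MvPolynomial.X l) _)
    (bggEval_pairLin u N hM 1 i f p' q hpq 1 _)

theorem bggEval_add {I : CochainComplex (GrMod (symGr n K)) ℤ} {m : ℤ} (p q : ℤ) (hpq : p + m = q)
    (f g : (homTerm (symGr_iSup n K) (bggObj N) I m).carrier)
    (x : PolyAlg n K ⊗[K] (⨁ k, bggV N p k)) :
    bggEval N p q hpq (f + g) x = bggEval N p q hpq f x + bggEval N p q hpq g x := rfl

theorem bggEval_sum {I : CochainComplex (GrMod (symGr n K)) ℤ} {m : ℤ} (p q : ℤ) (hpq : p + m = q)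
    {ι : Type*} (s : Finset ι) (f : ι → (homTerm (symGr_iSup n K) (bggObj N) I m).carrier)
    (x : PolyAlg n K ⊗[K] (⨁ k, bggV N p k)) :
    bggEval N p q hpq (∑ l ∈ s, f l) x = ∑ l ∈ s, bggEval N p q hpq (f l) x := by
  rw [map_sum, LinearMap.sum_apply]

theorem bggEval_pairLin_bggD_dual {M M' m' : ℤ} (hM' : M' = m' + 2 * n) (hMM : M + 1 = M') (i : ℤ)
    (f : bggV (extDualObj N) M i) (p q : ℤ) (hpq : p + m' = q) (k : ℤ) (z : bggV N p k) :
    bggEval N p q hpq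
      (pairLin u N hM' (bggD (extDualObj N) M M' hMM (1 ⊗ₜ[K] DirectSum.lof K ℤ _ i f)))
      (1 ⊗ₜ[K] DirectSum.lof K ℤ _ k z) =
    ∑ l, pairSign n m' i • bggPair N M' p i
        (yAct ((extDualObj N).X i) l (i - M) (i - M') (by lia) f)
        (DirectSum.lof K ℤ (bggV N p) k z) • (MvPolynomial.X l * 1 : PolyAlg n K) • u.elt q +
      pairSign n m' (i + 1) • (M.negOnePow • bggPair N M' p (i + 1)
        (grMap ((extDualObj N).d i (i + 1)) (i - M) (i + 1 - M') (by lia) f)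
        (DirectSum.lof K ℤ (bggV N p) k z)) • (1 * 1 : PolyAlg n K) • u.elt q := by
  rw [bggD_lof, map_add, map_sum, bggEval_add, bggEval_sum]
  exact congrArg₂ (· + ·)
    (Finset.sum_congr rfl fun l _ =>
      bggEval_pairLin u N hM' (MvPolynomial.X l) i _ p q hpq 1 _)
    ((bggEval_pairLin u N hM' 1 (i + 1) _ p q hpq 1 _).trans (congrArg
      (fun c : K => pairSign n m' (i + 1) • c • (1 * 1 : PolyAlg n K) • u.elt q)
      (bggPair_sign_left N _ _ _)))

theorem sign_smul_smul {P : Type*} [AddCommGroup P] [Module K P] (e : ℤˣ) (c : K) (y : P) :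
    (e • c) • y = e • c • y := by
  rcases Int.units_eq_one_or e with rfl | rfl
  · rw [one_smul, one_smul]
  · rw [Units.neg_smul, one_smul, Units.neg_smul, one_smul, neg_smul]

theorem sign_smul_congr {P : Type*} [AddCommGroup P] [Module K P] {e₁ e₂ e₃ e₄ : ℤˣ}
    (h : e₁ * e₂ = e₃ * e₄) (c : K) (y : P) : e₁ • e₂ • c • y = e₃ • (e₄ • c) • y := by
  rw [sign_smul_smul, smul_smul, smul_smul, h]

/-- The sign identity is demanded only where the coefficient is nonzero, because for the
differential of N it depends on the relation between p and M imposed by the degrees. -/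
theorem sign_smul_congr_of_ne {P : Type*} [AddCommGroup P] [Module K P] {e₁ e₂ e₃ e₄ e₅ e₆ : ℤˣ}
    (c : K) (h : c ≠ 0 → e₁ * e₂ * e₃ = e₄ * (e₅ * e₆)) (y : P) :
    e₁ • e₂ • (e₃ • c) • y = e₄ • (e₅ • e₆ • c) • y := by
  by_cases hc : c = 0
  · simp only [hc, smul_zero, zero_smul]
  · rw [sign_smul_smul, smul_smul, smul_smul, h hc, mul_smul, ← sign_smul_smul, mul_smul]

theorem CycleFamily.map_smul_smul (e : ℤˣ) (c : K) (s : PolyAlg n K) (q q' : ℤ) :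
    toLin (C.d q q') (e • c • s • u.elt q) = 0 := by
  rw [map_sign_smul, ← algebraMap_smul (PolyAlg n K), map_smul, map_smul, u.closed,
    smul_zero, smul_zero, smul_zero]

/-- Both sides are evaluated on generators 1 ⊗ f and 1 ⊗ z and compared summand by summand: the y_l
terms match by `bggPair_yAct`, the differential terms by `bggPair_d`. The y_l terms require
`pairSign` to change by (-1)^{i+1} when m increases by one, which explains its part m(i+1); the
differential terms then account for (n+1)i. -/
theorem pairLin_comm {M M' m m' : ℤ} (hM : M = m + 2 * n) (hM' : M' = m' + 2 * n)
    (hm : m + 1 = m') (hMM : M + 1 = M') :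
    bggHomD N C m m' ∘ₗ pairLin u N hM =
      pairLin u N hM' ∘ₗ bggD (extDualObj N) M M' hMM := by
  refine freeMod_lin_ext _ fun i f => bggEval_ext fun p q hpq k z => ?_
  refine (bggEval_bggHomD N hm (pairLin u N hM (1 ⊗ₜ[K] DirectSum.lof K ℤ _ i f)) p (p + 1) (q - 1)
    q hpq rfl (by lia) (1 ⊗ₜ[K] DirectSum.lof K ℤ _ k z)).trans
    (Eq.trans ?_ (bggEval_pairLin_bggD_dual u N hM' hMM i f p q hpq k z).symm)
  -- The values of the cochain are multiples of cycles, so the half of the Hom differential coming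
  -- from C vanishes.
  have h0 : toLin (C.d (q - 1) q) (bggEval N p (q - 1) (by lia)
      (pairLin u N hM (1 ⊗ₜ[K] DirectSum.lof K ℤ _ i f))
      (1 ⊗ₜ[K] DirectSum.lof K ℤ _ k z)) = 0 :=
    (congrArg _ (bggEval_pairLin u N hM 1 i f p (q - 1) (by lia) 1 _)).trans
      (u.map_smul_smul _ _ _ _ _)
  rw [h0, bggEval_pairLin_bggD u N hM i f p (p + 1) q rfl (by lia) k z, zero_add, smul_add,
    Finset.smul_sum]
  congr 1
  · refine Finset.sum_congr rfl fun l _ => ?_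
    rw [bggPair_yAct N hMM (p' := p + 1) rfl, one_mul, mul_one]
    refine sign_smul_congr ?_ _ _
    rw [pairSign, pairSign, ← Int.negOnePow_add, ← Int.negOnePow_add, Int.negOnePow_eq_iff]
    exact ⟨n - i + m, by rw [hM, ← hm]; ring⟩
  · rw [bggPair_d N hMM (p' := p + 1) rfl]
    refine sign_smul_congr_of_ne _ (fun hc => ?_) _
    -- A nonzero pairing pins down p, and with this value the parities of the two signs agree.
    have hp : p + 1 = n - M := by
      by_contra hp
      rw [bggPair_eq_zero N hp, LinearMap.zero_apply] at hc
      exact hc rfl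
    have hp' : p = n - M - 1 := by omega
    rw [pairSign, pairSign, ← Int.negOnePow_add, ← Int.negOnePow_add, ← Int.negOnePow_add,
      ← Int.negOnePow_add, Int.negOnePow_eq_iff]
    exact ⟨-i - 2 * n - m - 2, by rw [hp', hM, ← hm]; ring⟩

end DualMap

theorem GrMod.subsingleton_of_isZero {K A : Type u} [Field K] [Ring A] [Algebra K A]
    {𝒜 : ℤ → Submodule K A} {M : GrMod 𝒜} (h : Limits.IsZero M) : Subsingleton M.carrier := by
  refine subsingleton_of_forall_eq 0 fun x => ?_
  exact LinearMap.congr_fun (congrArg toLin ((Limits.IsZero.iff_id_eq_zero _).1 h)) x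

/-! ### Perfectness of the pairing and bijectivity of the comparison map -/

section Perfect

variable {n : ℕ} {K : Type u} [Field K] (N : CochainComplex (GrMod (extGr n K)) ℤ)

/-- The signed pairing of `⨁_i D_E(N)^i_{i-M}` with `⨁_k N^k_{k-p}`. -/
def bggDualPair (M m p : ℤ) :
    (⨁ i, bggV (extDualObj N) M i) →ₗ[K] Module.Dual K (⨁ k, bggV N p k) :=
  DirectSum.toModule K ℤ _ fun i => pairSign n m i • bggPair N M p i

theorem bggDualPair_lof (M m p i : ℤ) (f : bggV (extDualObj N) M i) (v : ⨁ k, bggV N p k) :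
    bggDualPair N M m p (DirectSum.lof K ℤ _ i f) v = pairSign n m i • bggPair N M p i f v := by
  rw [bggDualPair, DirectSum.toModule_lof]
  rfl

theorem bggDualPair_apply_lof (M m p i : ℤ) (w : ⨁ i, bggV (extDualObj N) M i)
    (z : bggV N p (-i)) :
    bggDualPair N M m p w (DirectSum.lof K ℤ (bggV N p) (-i) z) = pairSign n m i •
      extTop n K (dualVal N i (DirectSum.component K ℤ (bggV (extDualObj N) M) i w).1 z.1) := by
  induction w using DirectSum.induction_on with
  | zero =>
    rw [map_zero, LinearMap.zero_apply, map_zero, Submodule.coe_zero, map_zero,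
      LinearMap.zero_apply, map_zero, smul_zero]
  | add x y hx hy =>
    rw [map_add, LinearMap.add_apply, hx, hy, ← smul_add, map_add, Submodule.coe_add, map_add,
      LinearMap.add_apply, map_add]
  | of j f =>
    rw [← DirectSum.lof_eq_of K, bggDualPair_lof]
    by_cases hj : j = i
    · subst hj
      rw [DirectSum.component.lof_self, bggPair_lof N rfl, HomologicalComplex.XIsoOfEq_rfl]
      rfl
    · rw [DirectSum.component.of, dif_neg hj, bggPair_lof_of_ne N (by omega), Submodule.coe_zero,
        map_zero, LinearMap.zero_apply, map_zero, smul_zero, smul_zero]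

/-- Pairing w with N^{-i} sees only its i-th component, and for p = n - M the part of N^{-i} in
degree -i - p is exactly the one whose top coefficients determine a right linear map of degree i - M
(`dualPiece_eq_zero`). -/
theorem bggDualPair_injective {M p : ℤ} (m : ℤ) (hp : p = n - M) :
    Function.Injective (bggDualPair N M m p) := by
  refine (injective_iff_map_eq_zero _).2 fun w hw => ?_
  refine DirectSum.ext_component K fun i => ?_
  rw [map_zero]
  refine Subtype.ext (Subtype.ext ?_)
  refine dualPiece_eq_zero (N.X (-i)) (d := i - M) (j := -i - p) (by omega)
    (DirectSum.component K ℤ (bggV (extDualObj N) M) i w).2 fun z hz => ?_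
  have h := bggDualPair_apply_lof N M m p i w ⟨z, hz⟩
  rw [hw, LinearMap.zero_apply] at h
  exact ((smul_eq_zero_iff_eq _).1 h.symm)

theorem bggDualPair_surjective {M p : ℤ} (m : ℤ) (hp : p = n - M) (s : Finset ℤ)
    (hs : ∀ k ∉ s, Limits.IsZero (N.X k)) : Function.Surjective (bggDualPair N M m p) := by
  classical
  intro φ
  have key (i : ℤ) : ∃ f : bggV (extDualObj N) M i, ∀ z : bggV N p (-i),
      extTop n K (dualVal N i f.1 z.1) = φ (DirectSum.lof K ℤ (bggV N p) (-i) z) := by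
    obtain ⟨f, hf, hf'⟩ := exists_dualPiece (N.X (-i)) (d := i - M) (j := -i - p) (by omega)
      (φ ∘ₗ DirectSum.lof K ℤ (bggV N p) (-i))
    exact ⟨⟨⟨f, Submodule.subset_span (Set.mem_iUnion.2 ⟨_, hf⟩)⟩, hf⟩, hf'⟩
  choose f hf using key
  -- The functional is represented on each N^{-i} by `exists_dualPiece`; boundedness of N makes the
  -- representatives a finite sum. The inserted `pairSign` cancels the one in the pairing, its
  -- square being 1.
  refine ⟨∑ i ∈ s.image Neg.neg, DirectSum.lof K ℤ _ i (pairSign n m i • f i), ?_⟩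
  refine DirectSum.linearMap_ext K fun k => LinearMap.ext fun z => ?_
  obtain ⟨i, rfl⟩ : ∃ i, k = -i := ⟨-k, (neg_neg k).symm⟩
  change bggDualPair N M m p _ (DirectSum.lof K ℤ (bggV N p) (-i) z) =
    φ (DirectSum.lof K ℤ _ (-i) z)
  by_cases hi : -i ∈ s
  · rw [map_sum, LinearMap.sum_apply, Finset.sum_eq_single_of_mem i
      (Finset.mem_image.2 ⟨-i, hi, neg_neg i⟩)]
    · rw [bggDualPair_lof, bggPair_sign_left, smul_smul, ← sq, Int.units_sq, one_smul,
        bggPair_lof N rfl, HomologicalComplex.XIsoOfEq_rfl]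
      exact hf i z
    · intro j _ hj
      rw [bggDualPair_lof, bggPair_lof_of_ne N (by omega), smul_zero]
  · have := GrMod.subsingleton_of_isZero (hs _ hi)
    rw [Subsingleton.elim z 0, map_zero, map_zero, map_zero]

/-- E is finite-dimensional over K, so finitely generated E-modules are finite-dimensional, and only
finitely many N^k contribute. -/
theorem bggV_finite (p : ℤ) (s : Finset ℤ) (hs : ∀ k ∉ s, Limits.IsZero (N.X k))
    (hN : ∀ k, Module.Finite (ExtAlg n K) (N.X k).carrier) :
    (∀ k, Module.Finite K (bggV N p k)) ∧ Module.Finite K (⨁ k, bggV N p k) := by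
  have h1 (k : ℤ) : Module.Finite K (bggV N p k) := by
    have := hN k
    have : Module.Finite K (N.X k).carrier := Module.Finite.trans (ExtAlg n K) _
    infer_instance
  refine ⟨h1, Module.Finite.of_surjective
    (∑ k : s, DirectSum.lof K ℤ (bggV N p) k ∘ₗ LinearMap.proj (φ := fun k : s => bggV N p k) k) ?_⟩
  classical
  rw [← LinearMap.range_eq_top, eq_top_iff]
  rintro v -
  induction v using DirectSum.induction_on with
  | zero => exact Submodule.zero_mem _
  | add x y hx hy => exact Submodule.add_mem _ hx hy
  | of k z =>
    by_cases hk : k ∈ s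
    · refine ⟨Pi.single ⟨k, hk⟩ z, ?_⟩
      rw [LinearMap.sum_apply, Finset.sum_eq_single_of_mem ⟨k, hk⟩ (Finset.mem_univ _)]
      · rw [LinearMap.comp_apply, LinearMap.proj_apply, Pi.single_eq_same]
        rfl
      · intro j _ hj
        rw [LinearMap.comp_apply, LinearMap.proj_apply, Pi.single_eq_of_ne hj, map_zero]
    · have := GrMod.subsingleton_of_isZero (hs _ hk)
      rw [Subsingleton.elim z 0, map_zero]
      exact Submodule.zero_mem _

/-- The map `S ⊗ W → Hom_K(V, S)` induced by the signed pairing of `W` and `V`. -/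
def bggTensorPair (M m p : ℤ) : PolyAlg n K ⊗[K] (⨁ i, bggV (extDualObj N) M i) →ₗ[K]
    ((⨁ k, bggV N p k) →ₗ[K] PolyAlg n K) :=
  dualTensorHom K (⨁ k, bggV N p k) (PolyAlg n K) ∘ₗ
    (TensorProduct.comm K (PolyAlg n K) (Module.Dual K (⨁ k, bggV N p k))).toLinearMap ∘ₗ
    (bggDualPair N M m p).lTensor (PolyAlg n K)

theorem bggTensorPair_tmul (M m p : ℤ) (s : PolyAlg n K) (w : ⨁ i, bggV (extDualObj N) M i)
    (v : ⨁ k, bggV N p k) :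
    bggTensorPair N M m p (s ⊗ₜ[K] w) v = bggDualPair N M m p w v • s := by
  change dualTensorHom K _ _ (bggDualPair N M m p w ⊗ₜ[K] s) v = _
  rw [dualTensorHom_apply]

/-- A composite of isomorphisms: the perfect pairing tensored with S, the swap of the factors, and
V^* ⊗ S ≅ Hom_K(V, S) for finite-dimensional V. -/
theorem bggTensorPair_bijective {M p : ℤ} (m : ℤ) (hp : p = n - M) (s : Finset ℤ)
    (hs : ∀ k ∉ s, Limits.IsZero (N.X k))
    (hN : ∀ k, Module.Finite (ExtAlg n K) (N.X k).carrier) :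
    Function.Bijective (bggTensorPair N M m p) := by
  have := (bggV_finite N p s hs hN).2
  have h1 : Function.Bijective (dualTensorHom K (⨁ k, bggV N p k) (PolyAlg n K)) := by
    have h : ⇑(dualTensorHom K (⨁ k, bggV N p k) (PolyAlg n K)) =
      dualTensorHomEquiv K (⨁ k, bggV N p k) (PolyAlg n K) := rfl
    rw [h]
    exact LinearEquiv.bijective _
  have h2 : Function.Bijective ((bggDualPair N M m p).lTensor (PolyAlg n K)) :=
    (LinearEquiv.lTensor (PolyAlg n K) (LinearEquiv.ofBijective (bggDualPair N M m p)
      ⟨bggDualPair_injective N m hp, bggDualPair_surjective N m hp s hs⟩)).bijective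
  exact h1.comp ((TensorProduct.comm K (PolyAlg n K)
    (Module.Dual K (⨁ k, bggV N p k))).bijective.comp h2)

variable {C : CochainComplex (GrMod (symGr n K)) ℤ} (u : CycleFamily C)

/-- An S-linear map on S ⊗ V amounts to a K-linear map on V; in these terms the comparison map is
`bggTensorPair` followed by s ↦ s u. -/
theorem bggEval_pairLin_one {M m : ℤ} (hM : M = m + 2 * n) (p q : ℤ) (hpq : p + m = q)
    (t : PolyAlg n K ⊗[K] (⨁ i, bggV (extDualObj N) M i)) (v : ⨁ k, bggV N p k) :
    bggEval N p q hpq (pairLin u N hM t) (1 ⊗ₜ[K] v) = bggTensorPair N M m p t v • u.elt q := by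
  let F : PolyAlg n K ⊗[K] (⨁ i, bggV (extDualObj N) M i) →ₗ[K] (C.X q).carrier :=
    (LinearMap.applyₗ (1 ⊗ₜ[K] v) ∘ₗ bggEval N p q hpq ∘ₗ pairLin u N hM).restrictScalars K
  let G : PolyAlg n K ⊗[K] (⨁ i, bggV (extDualObj N) M i) →ₗ[K] (C.X q).carrier :=
    (LinearMap.toSpanSingleton (PolyAlg n K) _ (u.elt q)).restrictScalars K ∘ₗ
      LinearMap.applyₗ v ∘ₗ bggTensorPair N M m p
  suffices h : F = G from LinearMap.congr_fun h t
  refine TensorProduct.ext (LinearMap.ext fun s => DirectSum.linearMap_ext K fun i =>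
    LinearMap.ext fun f => ?_)
  refine (bggEval_pairLin u N hM s i f p q hpq 1 v).trans ?_
  change _ = bggTensorPair N M m p (s ⊗ₜ[K] DirectSum.lof K ℤ _ i f) v • u.elt q
  rw [bggTensorPair_tmul, bggDualPair_lof, mul_one, sign_smul_smul]
  generalize bggPair N M p i f v = c
  rcases Int.units_eq_one_or (pairSign n m i) with h | h
  · rw [h, one_smul, one_smul, smul_assoc]
  · rw [h, Units.neg_smul, one_smul, Units.neg_smul, one_smul, neg_smul, smul_assoc]

/-- Since C lives only in degree -n, a cochain of degree m is a single S-linear map from L(N)^p with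
p = -n - m = n - M. As the target is free on u, this is a K-linear map V → S, so bijectivity reduces
to `bggTensorPair_bijective`. -/
theorem pairLin_bijective {M m : ℤ} (hM : M = m + 2 * n) (s : Finset ℤ)
    (hs : ∀ k ∉ s, Limits.IsZero (N.X k))
    (hN : ∀ k, Module.Finite (ExtAlg n K) (N.X k).carrier)
    (hC : ∀ q : ℤ, q ≠ -n → Limits.IsZero (C.X q))
    (hu : Function.Bijective (LinearMap.toSpanSingleton (PolyAlg n K) _ (u.elt (-n)))) :
    Function.Bijective (pairLin u N hM) := by
  have hb := bggTensorPair_bijective N m (M := M) (p := n - M) rfl s hs hN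
  have hpq : (n : ℤ) - M + m = -n := by omega
  constructor
  · refine (injective_iff_map_eq_zero _).2 fun t ht => ?_
    refine (injective_iff_map_eq_zero _).1 hb.1 t (LinearMap.ext fun v => ?_)
    refine hu.1 ?_
    rw [LinearMap.toSpanSingleton_apply, ← bggEval_pairLin_one N u hM _ _ hpq t v, ht,
      LinearMap.zero_apply, map_zero, map_zero]
    rfl
  · intro g
    let σ := LinearEquiv.ofBijective _ hu
    obtain ⟨t, ht⟩ := hb.2 (σ.symm.toLinearMap.restrictScalars K ∘ₗ
      (bggEval N (n - M) (-n) hpq g).restrictScalars K ∘ₗ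
        TensorProduct.mk K (PolyAlg n K) (⨁ k, bggV N (n - M) k) 1)
    refine ⟨t, bggEval_ext fun p q h k z => ?_⟩
    by_cases hq : q = -n
    · subst hq
      obtain rfl : p = n - M := by omega
      rw [bggEval_pairLin_one, ht]
      exact σ.apply_symm_apply _
    · have := GrMod.subsingleton_of_isZero (hC q hq)
      exact Subsingleton.elim _ _

end Perfect

/-! ### L(N) is bounded, K-projective, and has only sums of homogeneous cochains -/

section Bounded

variable {n : ℕ} {K : Type u} [Field K]

theorem GrMod.isZero_of_subsingleton {K A : Type u} [Field K] [Ring A] [Algebra K A]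
    {𝒜 : ℤ → Submodule K A} {M : GrMod 𝒜} (h : Subsingleton M.carrier) : Limits.IsZero M :=
  (Limits.IsZero.iff_id_eq_zero _).2 (hom_ext (LinearMap.ext fun _ => Subsingleton.elim _ _))

/-- The finitely many nonzero terms of a bounded complex. -/
theorem GrMod.boundedFG.exists_finset {N : CochainComplex (GrMod (extGr n K)) ℤ}
    (h : boundedFG (extGr n K) N) : ∃ s : Finset ℤ, ∀ k ∉ s, Limits.IsZero (N.X k) := by
  obtain ⟨⟨a, b, hab⟩, -⟩ := h
  refine ⟨Finset.Icc a b, fun k hk => hab k ?_⟩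
  rw [Finset.mem_Icc] at hk
  omega

/-- `L(N)` is bounded if `N` is bounded with finitely generated terms. -/
theorem bggObj_bounded {N : CochainComplex (GrMod (extGr n K)) ℤ}
    (h : boundedFG (extGr n K) N) :
    ∃ a b : ℤ, ∀ m, m < a ∨ b < m → Limits.IsZero ((bggObj N).X m) := by
  obtain ⟨s, hs⟩ := h.exists_finset
  -- Each N^k is finite-dimensional, hence has finitely many nonzero graded pieces, and m ↦ k - m is
  -- injective; so only finitely many m give a nonzero term of L(N).
  have hfin : (⋃ k ∈ s, {m : ℤ | (N.X k).gr (k - m) ≠ ⊥}).Finite := by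
    refine s.finite_toSet.biUnion fun k _ => ?_
    have := h.2 k
    have : Module.Finite K (N.X k).carrier := Module.Finite.trans (ExtAlg n K) _
    exact (WellFoundedGT.finite_ne_bot_of_iSupIndep
      (N.X k).internal.submodule_iSupIndep).preimage (sub_right_injective (b := k)).injOn
  obtain ⟨a, ha⟩ := hfin.bddBelow
  obtain ⟨b, hb⟩ := hfin.bddAbove
  refine ⟨a, b, fun m hm => GrMod.isZero_of_subsingleton ?_⟩
  have h1 (k : ℤ) : Subsingleton (bggV N m k) := by
    by_cases hk : k ∈ s
    · have h2 : (N.X k).gr (k - m) = ⊥ := by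
        by_contra hne
        have hmem : m ∈ ⋃ k ∈ s, {m : ℤ | (N.X k).gr (k - m) ≠ ⊥} :=
          Set.mem_biUnion (Finset.mem_coe.2 hk) hne
        rcases hm with hm | hm
        · exact absurd (ha hmem) (not_le.2 hm)
        · exact absurd (hb hmem) (not_le.2 hm)
      exact (Submodule.subsingleton_iff_eq_bot).2 h2
    · have := GrMod.subsingleton_of_isZero (hs k hk)
      infer_instance
  have h2 : Subsingleton (⨁ k, bggV N m k) :=
    ⟨fun x y => DFinsupp.ext fun k => Subsingleton.elim _ _⟩
  have h3 (x : PolyAlg n K ⊗[K] (⨁ k, bggV N m k)) : x = 0 := by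
    induction x with
    | zero => rfl
    | add x y hx hy => rw [hx, hy, add_zero]
    | tmul s v => rw [Subsingleton.elim v 0, TensorProduct.tmul_zero]
  exact subsingleton_of_forall_eq (0 : PolyAlg n K ⊗[K] (⨁ k, bggV N m k)) h3

/-- The terms are base changes of vector spaces, hence free, and a bounded above complex of
projectives is K-projective. -/
theorem isKProjective_under_bggObj {N : CochainComplex (GrMod (extGr n K)) ℤ}
    (h : boundedFG (extGr n K) N) : (under (bggObj N)).IsKProjective := by
  obtain ⟨a, b, hab⟩ := bggObj_bounded h
  have : (under (bggObj N)).IsStrictlyLE b := by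
    rw [CochainComplex.isStrictlyLE_iff]
    exact fun i hi => isZero_under (hab i (Or.inr hi))
  have (p : ℤ) : Projective ((under (bggObj N)).X p) :=
    (IsProjective.iff_projective (R := PolyAlg n K)
      (PolyAlg n K ⊗[K] (⨁ k, bggV N p k))).1 inferInstance
  exact CochainComplex.isKProjective_of_projective _ b

theorem homTotal_bggObj {N : CochainComplex (GrMod (extGr n K)) ℤ}
    (h : boundedFG (extGr n K) N) (I : CochainComplex (GrMod (symGr n K)) ℤ) :
    HomTotal (bggObj N) I := by
  obtain ⟨a, b, hab⟩ := bggObj_bounded h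
  obtain ⟨s, hs⟩ := h.exists_finset
  refine homTotal_of_bounded _ _ a b hab fun p q T hT f => ?_
  have := (bggV_finite N p s hs h.2).1
  refine freeMod_mem_of_homogeneous (bggV N p) (fun i => i - p) s (fun k hk => ?_) (I.X q) T hT f
  have := GrMod.subsingleton_of_isZero (hs k hk)
  infer_instance

end Bounded

/-! ### The generator of S(-n)[n] -/

section Canonical

variable (n : ℕ) (K : Type u) [Field K]

/-- The generator of `S(-n)[n]`. -/
def canonicalElt (q : ℤ) : ((canonicalComplex n K).X q).carrier :=
  if h : q + n = 0 then
    toLin (HomologicalComplex.singleObjXIsoOfEq (ComplexShape.up ℤ) 0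
      ((twist (symGr n K) (-(n : ℤ))).obj (symMod n K)) (q + n) h).inv (1 : PolyAlg n K)
  else 0

theorem canonicalElt_eq {q : ℤ} (h : q + n = 0) : canonicalElt n K q =
    toLin (HomologicalComplex.singleObjXIsoOfEq (ComplexShape.up ℤ) 0
      ((twist (symGr n K) (-(n : ℤ))).obj (symMod n K)) (q + n) h).inv (1 : PolyAlg n K) :=
  dif_pos h

theorem canonicalElt_eq_zero {q : ℤ} (h : ¬q + n = 0) : canonicalElt n K q = 0 :=
  dif_neg h

theorem canonicalComplex_d (q q' : ℤ) : (canonicalComplex n K).d q q' = 0 := by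
  have h (X Y : GrMod (symGr n K)) : (n : ℤ).negOnePow • (0 : X ⟶ Y) = 0 := smul_zero _
  exact h _ _

/-- The generators of `S(-n)[n]`, as a family of cycles. -/
def canonicalCycles : CycleFamily (canonicalComplex n K) where
  elt := canonicalElt n K
  mem q := by
    by_cases h : q + n = 0
    · rw [canonicalElt_eq n K h]
      refine toLin_mem (HomologicalComplex.singleObjXIsoOfEq (ComplexShape.up ℤ) 0
        ((twist (symGr n K) (-(n : ℤ))).obj (symMod n K)) (q + n) h).inv (i := n) ?_
      -- The generator 1 has degree n in S(-n), since S(-n)_n = S_0.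
      change (1 : PolyAlg n K) ∈ symGr n K (n + -n)
      rw [add_neg_cancel]
      exact SetLike.GradedOne.one_mem
    · rw [canonicalElt_eq_zero n K h]
      exact Submodule.zero_mem _
  closed q q' := by rw [canonicalComplex_d, toLin_zero, LinearMap.zero_apply]

theorem isZero_canonicalComplex (q : ℤ) (hq : q ≠ -n) :
    Limits.IsZero ((canonicalComplex n K).X q) :=
  HomologicalComplex.isZero_single_obj_X (ComplexShape.up ℤ) 0
    ((twist (symGr n K) (-(n : ℤ))).obj (symMod n K)) (q + n) (by omega)

theorem GrMod.bijective_toLin {K A : Type u} [Field K] [Ring A] [Algebra K A]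
    {𝒜 : ℤ → Submodule K A} {M N : GrMod 𝒜} (e : M ≅ N) : Function.Bijective (toLin e.hom) :=
  Function.bijective_iff_has_inverse.2 ⟨toLin e.inv,
    fun x => LinearMap.congr_fun (congrArg toLin e.hom_inv_id) x,
    fun x => LinearMap.congr_fun (congrArg toLin e.inv_hom_id) x⟩

/-- The map s ↦ s u is the isomorphism identifying S with the only nonzero term, because that
isomorphism is S-linear and sends 1 to u. -/
theorem canonicalElt_bijective : Function.Bijective
    (LinearMap.toSpanSingleton (PolyAlg n K) _ ((canonicalCycles n K).elt (-n))) := by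
  have h := GrMod.bijective_toLin (HomologicalComplex.singleObjXIsoOfEq (ComplexShape.up ℤ) 0
    ((twist (symGr n K) (-(n : ℤ))).obj (symMod n K)) (-n + n) (neg_add_cancel _)).symm
  have aux {Z : GrMod (symGr n K)} (ψ : PolyAlg n K →ₗ[PolyAlg n K] Z.carrier)
      (s : PolyAlg n K) : s • ψ 1 = ψ s := by
    rw [← map_smul, smul_eq_mul, mul_one]
  have heq (s : PolyAlg n K) : s • canonicalElt n K (-n) =
      toLin (HomologicalComplex.singleObjXIsoOfEq (ComplexShape.up ℤ) 0
        ((twist (symGr n K) (-(n : ℤ))).obj (symMod n K)) (-n + n) (neg_add_cancel _)).inv s := by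
    rw [canonicalElt_eq n K (neg_add_cancel _)]
    exact aux (Z := (canonicalComplex n K).X (-n))
      (toLin (HomologicalComplex.singleObjXIsoOfEq (ComplexShape.up ℤ) 0
        ((twist (symGr n K) (-(n : ℤ))).obj (symMod n K)) (-n + n) (neg_add_cancel _)).inv) s
  exact (congrArg Function.Bijective (funext heq)).mpr h

end Canonical

/-! ### Naturality of the comparison map and passage to ω -/

section Functor

variable {n : ℕ} {K : Type u} [Field K]
  {C : CochainComplex (GrMod (symGr n K)) ℤ} (u : CycleFamily C)

/-- A shift by k multiplies differentials by (-1)^k, which is trivial here as 2n is even. -/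
theorem twistShift_d (X : CochainComplex (GrMod (symGr n K)) ℤ) (m m' : ℤ) :
    ((twistShift n K (-(2 * (n : ℤ))) (2 * (n : ℤ))).obj X).d m m' =
      (twist (symGr n K) (-(2 * (n : ℤ)))).map (X.d (m + 2 * n) (m' + 2 * n)) := by
  have h : (2 * (n : ℤ)).negOnePow = 1 := Int.negOnePow_even _ (even_two_mul _)
  exact (congrArg (fun e : ℤˣ => e • (twist (symGr n K) (-(2 * (n : ℤ)))).map
    (X.d (m + 2 * n) (m' + 2 * n))) h).trans (one_smul _ _)

/-- The chain map `L(D_E(N))(-2n)[2n] → Hom•(L(N), C)`. -/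
def pairChainMap (N : CochainComplex (GrMod (extGr n K)) ℤ) :
    (twistShift n K (-(2 * (n : ℤ))) (2 * (n : ℤ))).obj (bggObj (extDualObj N)) ⟶
      homComplex (symGr_iSup n K) (bggObj N) C where
  f m := pairMor u N (M := m + 2 * n) (m := m) rfl
  comm' m m' hm := by
    have hm : m + 1 = m' := hm
    have hM : m + 2 * n + 1 = m' + 2 * n := by omega
    rw [twistShift_d, bggObj_d _ _ _ hM]
    exact hom_ext (pairLin_comm u N rfl rfl hm hM)

/-- D_E acts on morphisms by transposition, so both sides are top(f(g z)); `pairLin_naturality`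
follows on generators. -/
theorem bggPair_map {N N' : CochainComplex (GrMod (extGr n K)) ℤ} (g : N ⟶ N') (M p i : ℤ)
    (f : bggV (extDualObj N') M i) (k : ℤ) (z : bggV N p k) :
    bggPair N M p i (grMap (((extDual n K).map g.op).f i) (i - M) (i - M) rfl f)
      (DirectSum.lof K ℤ (bggV N p) k z) =
    bggPair N' M p i f (DirectSum.lof K ℤ (bggV N' p) k (grMap (g.f k) (k - p) (k - p) rfl z)) := by
  by_cases hk : k = -i
  · subst hk
    refine (bggPair_lof N rfl _ z).trans (Eq.trans ?_ (bggPair_lof N' rfl f _).symm)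
    rw [HomologicalComplex.XIsoOfEq_rfl, HomologicalComplex.XIsoOfEq_rfl]
    rfl
  · exact (bggPair_lof_of_ne N hk _ z).trans (bggPair_lof_of_ne N' hk f _).symm

/-- Precomposition with `L(g)`, as a linear map. -/
def bggPrecomp (C : CochainComplex (GrMod (symGr n K)) ℤ)
    {N N' : CochainComplex (GrMod (extGr n K)) ℤ} (g : N ⟶ N') (m : ℤ) :
    (homTerm (symGr_iSup n K) (bggObj N') C m).carrier →ₗ[PolyAlg n K]
      (homTerm (symGr_iSup n K) (bggObj N) C m).carrier :=
  toLin ((homComplexMap (symGr_iSup n K) (bggMap g) C).f m)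

theorem bggEval_bggPrecomp {N N' : CochainComplex (GrMod (extGr n K)) ℤ} (g : N ⟶ N') (m : ℤ)
    (f : (homTerm (symGr_iSup n K) (bggObj N') C m).carrier) (p q : ℤ) (hpq : p + m = q) (k : ℤ)
    (z : bggV N p k) :
    bggEval N p q hpq (bggPrecomp C g m f) (1 ⊗ₜ[K] DirectSum.lof K ℤ (bggV N p) k z) =
      bggEval N' p q hpq f
        (1 ⊗ₜ[K] DirectSum.lof K ℤ (bggV N' p) k (grMap (g.f k) (k - p) (k - p) rfl z)) := by
  change (((Cochain.ofHom (underMap (bggMap g))).comp f.1 (zero_add m)).v p q hpq).hom _ = _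
  rw [Cochain.zero_cochain_comp_v, Cochain.ofHom_v]
  change bggEval N' p q hpq f
    (1 ⊗ₜ[K] bggMapV g p (DirectSum.lof K ℤ (bggV N p) k z)) = _
  rw [bggMapV_lof]

theorem pairLin_naturality {N N' : CochainComplex (GrMod (extGr n K)) ℤ} (g : N ⟶ N') {M m : ℤ}
    (hM : M = m + 2 * n) :
    pairLin u N hM ∘ₗ (bggMapV ((extDual n K).map g.op) M).baseChange (PolyAlg n K) =
      bggPrecomp C g m ∘ₗ pairLin u N' hM := by
  refine freeMod_lin_ext _ fun i f => bggEval_ext fun p q hpq k z => ?_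
  change bggEval N p q hpq (pairLin u N hM (1 ⊗ₜ[K] bggMapV ((extDual n K).map g.op) M
      (DirectSum.lof K ℤ (bggV (extDualObj N') M) i f)))
      (1 ⊗ₜ[K] DirectSum.lof K ℤ (bggV N p) k z) =
    bggEval N p q hpq (bggPrecomp C g m (pairLin u N' hM (1 ⊗ₜ[K] DirectSum.lof K ℤ _ i f)))
      (1 ⊗ₜ[K] DirectSum.lof K ℤ (bggV N p) k z)
  refine Eq.trans ?_ (bggEval_bggPrecomp g m _ p q hpq k z).symm
  refine Eq.trans ?_ (bggEval_pairLin u N' hM 1 i f p q hpq 1 _).symm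
  refine (congrArg (fun w => bggEval N p q hpq (pairLin u N hM (1 ⊗ₜ[K] w))
    (1 ⊗ₜ[K] DirectSum.lof K ℤ (bggV N p) k z))
    (bggMapV_lof ((extDual n K).map g.op) M i f)).trans ?_
  refine (bggEval_pairLin u N hM 1 i _ p q hpq 1 _).trans ?_
  exact congrArg (fun c : K => pairSign n m i • c • (1 * 1 : PolyAlg n K) • u.elt q)
    (bggPair_map g M p i f k z)

/-- The natural transformation `L(D_E(-))(-2n)[2n] → Hom•(L(-), C)`. -/
def pairNatTrans :
    extDual n K ⋙ bggL n K ⋙ twistShift n K (-(2 * (n : ℤ))) (2 * (n : ℤ)) ⟶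
      (bggL n K).op ⋙ symDual C where
  app N := pairChainMap u N.unop
  naturality N' N g := by
    ext m : 1
    exact hom_ext (pairLin_naturality u g.unop (M := m + 2 * n) (m := m) rfl)

/-- The chain map is bijective in every degree, so it is even an isomorphism on underlying
complexes. -/
theorem quasiIso_pairChainMap {N : CochainComplex (GrMod (extGr n K)) ℤ}
    (h : boundedFG (extGr n K) N) :
    quasiIso (symGr n K) (pairChainMap (canonicalCycles n K) N) := by
  obtain ⟨s, hs⟩ := h.exists_finset
  have (m : ℤ) : IsIso ((underMap (pairChainMap (canonicalCycles n K) N)).f m) := by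
    rw [ConcreteCategory.isIso_iff_bijective]
    exact pairLin_bijective N (canonicalCycles n K) (M := m + 2 * n) (m := m) rfl s hs h.2
      (isZero_canonicalComplex n K) (canonicalElt_bijective n K)
  have : IsIso (underMap (pairChainMap (canonicalCycles n K) N)) :=
    HomologicalComplex.Hom.isIso_of_components _
  change QuasiIso (underMap (pairChainMap (canonicalCycles n K) N))
  infer_instance

/-- The natural transformation `L(D_E(-))(-2n)[2n] → Hom•(L(-), ω)` given by an augmentation
`S(-n)[n] → ω`. -/
def dualityNatTrans {ω : CochainComplex (GrMod (symGr n K)) ℤ} (η : canonicalComplex n K ⟶ ω) :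
    extDual n K ⋙ bggL n K ⋙ twistShift n K (-(2 * (n : ℤ))) (2 * (n : ℤ)) ⟶
      (bggL n K).op ⋙ symDual ω :=
  pairNatTrans (canonicalCycles n K) ≫
    Functor.whiskerLeft (bggL n K).op (homFunctorPost (symGr_iSup n K) η)

theorem quasiIso_dualityNatTrans {ω : CochainComplex (GrMod (symGr n K)) ℤ}
    (η : canonicalComplex n K ⟶ ω) (hη : quasiIso (symGr n K) η)
    {N : CochainComplex (GrMod (extGr n K)) ℤ} (h : boundedFG (extGr n K) N) :
    quasiIso (symGr n K) ((dualityNatTrans η).app (Opposite.op N)) := by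
  have := isKProjective_under_bggObj h
  have h1 : QuasiIso (underMap (pairChainMap (canonicalCycles n K) N)) := quasiIso_pairChainMap h
  have h2 : QuasiIso (underMap (homComplexPost (symGr_iSup n K) (bggObj N) η)) :=
    quasiIso_homComplexPost (symGr_iSup n K) (bggObj N) η hη (homTotal_bggObj h _)
      (homTotal_bggObj h _)
  have h3 : underMap ((dualityNatTrans η).app (Opposite.op N)) =
      underMap (pairChainMap (canonicalCycles n K) N) ≫
        underMap (homComplexPost (symGr_iSup n K) (bggObj N) η) := rfl
  change QuasiIso (underMap ((dualityNatTrans η).app (Opposite.op N)))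
  rw [h3]
  exact quasiIso_comp (hφ := h1) (hφ' := h2) _ _

end Functor

end

/-! ### Conclusion in the derived category -/

theorem proposition1p5 {K : Type u} [Field K] (n : ℕ)
    (ω : CochainComplex (GrMod (symGr n K)) ℤ) (η : canonicalComplex n K ⟶ ω)
    (hω : GrMod.IsInjectiveResolution η) :
    Nonempty
      ((GrMod.boundedFG (extGr n K)).ι.op ⋙ (bggL n K).op ⋙ symDual ω ⋙
          GrMod.Derived.Q (symGr n K) ≅
        (GrMod.boundedFG (extGr n K)).ι.op ⋙ extDual n K ⋙ bggL n K ⋙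
          twistShift n K (-(2 * (n : ℤ))) (2 * (n : ℤ)) ⋙ GrMod.Derived.Q (symGr n K)) := by
  -- The comparison goes from L(D_E(-)) to D_S(L(-)), opposite to the stated isomorphism. It exists
  -- on all complexes, and the restriction to bounded finitely generated ones makes its components
  -- quasi-isomorphisms, which the localization inverts.
  let α : (GrMod.boundedFG (extGr n K)).ι.op ⋙ extDual n K ⋙ bggL n K ⋙
      twistShift n K (-(2 * (n : ℤ))) (2 * (n : ℤ)) ⋙ GrMod.Derived.Q (symGr n K) ⟶
      (GrMod.boundedFG (extGr n K)).ι.op ⋙ (bggL n K).op ⋙ symDual ω ⋙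
        GrMod.Derived.Q (symGr n K) :=
    Functor.whiskerLeft (GrMod.boundedFG (extGr n K)).ι.op
      (Functor.whiskerRight (dualityNatTrans η) (GrMod.Derived.Q (symGr n K)))
  have (N : ((GrMod.boundedFG (extGr n K)).FullSubcategory)ᵒᵖ) : IsIso (α.app N) :=
    Localization.inverts (GrMod.Derived.Q (symGr n K)) (GrMod.quasiIso (symGr n K)) _
      (quasiIso_dualityNatTrans η hω.quasi_iso N.unop.property)
  have : IsIso α := NatIso.isIso_of_isIso_app α
  exact ⟨(asIso α).symm⟩
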